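/- Let $h:[0,\infty)\to[0,\infty)$ be operator monotone (for all $m$ and all positive semidefinite $m\times m$ complex matrices, $A\le B$ implies $h(A)\le h(B)$) with $h(1)=1$, and let $\sigma$ be the operator mean with representing function $h$: for positive semidefinite $n\times n$ complex matrices $A,B$, $$A\,\sigma\,B=A^{1/2}\,h\bigl(A^{-1/2}BA^{-1/2}\bigr)\,A^{1/2}\ \text{ if } A,B \text{ are invertible},\qquad A\,\sigma\,B=\lim_{\varepsilon\searrow0}(A+\varepsilon I)\,\sigma\,(B+\varepsilon I)\ \text{ in general},$$ and likewise for scalars $a,b\ge 0$ (regarded as $1\times1$ matrices), so $a\,\sigma\,b=\lim_{\varepsilon\searrow0}(a+\varepsilon)\,h\bigl(\tfrac{b+\varepsilon}{a+\varepsilon}\bigr)$. These limits exist. Write $\mu_1(X)\ge\dots\ge\mu_n(X)$ for the singular values of an $n\times n$ matrix $X$, in decreasing order with multiplicities. (i) Assume that $h$ is geometrically convex, i.e. $h(\sqrt{xy})\le\sqrt{h(x)h(y)}$ for all $x,y\ge0$. Then, for all $n$, all positive semidefinite $n\times n$ complex matrices $A,B$, and all $k=1,\dots,n$, $$\Bigl\{\prod_{j=1}^k\mu_j(A\,\sigma\,B)\Bigr\}^{1/k}\ge\Bigl\{\prod_{j=1}^k\mu_j(A)\Bigr\}^{1/k}\,\sigma\,\Bigl\{\prod_{j=n+1-k}^n\mu_j(B)\Bigr\}^{1/k},$$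 $$\Bigl\{\prod_{j=1}^k\mu_j(A\,\sigma\,B)\Bigr\}^{1/k}\ge\Bigl\{\prod_{j=n+1-k}^n\mu_j(A)\Bigr\}^{1/k}\,\sigma\,\Bigl\{\prod_{j=1}^k\mu_j(B)\Bigr\}^{1/k}.$$ (ii) Assume that $h$ is geometrically concave, i.e. $h(\sqrt{xy})\ge\sqrt{h(x)h(y)}$ for all $x,y\ge0$. Then, for all $n$, all positive semidefinite $n\times n$ complex matrices $A,B$, and all $k=1,\dots,n$, $$\Bigl\{\prod_{j=n+1-k}^n\mu_j(A\,\sigma\,B)\Bigr\}^{1/k}\le\Bigl\{\prod_{j=n+1-k}^n\mu_j(A)\Bigr\}^{1/k}\,\sigma\,\Bigl\{\prod_{j=1}^k\mu_j(B)\Bigr\}^{1/k},$$ $$\Bigl\{\prod_{j=n+1-k}^n\mu_j(A\,\sigma\,B)\Bigr\}^{1/k}\le\Bigl\{\prod_{j=1}^k\mu_j(A)\Bigr\}^{1/k}\,\sigma\,\Bigl\{\prod_{j=n+1-k}^n\mu_j(B)\Bigr\}^{1/k}.$$ -/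

import Mathlib

open Filter Topology
open scoped MatrixOrder ComplexOrder

namespace OpMean

/-- A real function `h` is operator monotone on `[0, ∞)`: for positive semidefinite complex
matrices `A ≤ B` (Loewner order) of any size, `h(A) ≤ h(B)`. Here `cfc h A` is the functional
calculus (every `h` is continuous on the finite spectrum of a matrix). -/
def IsOperatorMonotone (h : ℝ → ℝ) : Prop :=
  ∀ (n : ℕ) (A B : Matrix (Fin n) (Fin n) ℂ), A.PosSemidef → B.PosSemidef →
    (B - A).PosSemidef → (cfc h B - cfc h A).PosSemidef

/-- `h` represents an operator mean: it is a non-negative operator monotone function on `[0, ∞)`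
with `h 1 = 1`. -/
structure IsRepresentingFunction (h : ℝ → ℝ) : Prop where
  nonneg : ∀ t : ℝ, 0 ≤ t → 0 ≤ h t
  operatorMonotone : IsOperatorMonotone h
  map_one : h 1 = 1

/-- Geometric convexity on `[0, ∞)`. -/
def GeomConvex (h : ℝ → ℝ) : Prop :=
  ∀ x y : ℝ, 0 ≤ x → 0 ≤ y → h (√(x * y)) ≤ √(h x * h y)

/-- Geometric concavity on `[0, ∞)`. -/
def GeomConcave (h : ℝ → ℝ) : Prop :=
  ∀ x y : ℝ, 0 ≤ x → 0 ≤ y → √(h x * h y) ≤ h (√(x * y))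

/-- The operator mean with representing function `h` on invertible positive matrices:
`A^{1/2} h(A^{-1/2} B A^{-1/2}) A^{1/2}`. -/
noncomputable def invMean (h : ℝ → ℝ) {n : ℕ} (A B : Matrix (Fin n) (Fin n) ℂ) :
    Matrix (Fin n) (Fin n) ℂ :=
  CFC.sqrt A * cfc h ((CFC.sqrt A)⁻¹ * B * (CFC.sqrt A)⁻¹) * CFC.sqrt A

/-- `(A + ε I) σ (B + ε I)`; both arguments are invertible if `A, B ≥ 0` and `ε > 0`. -/
noncomputable def shiftedMean (h : ℝ → ℝ) {n : ℕ} (A B : Matrix (Fin n) (Fin n) ℂ) (ε : ℝ) :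
    Matrix (Fin n) (Fin n) ℂ :=
  invMean h (A + ε • (1 : Matrix (Fin n) (Fin n) ℂ)) (B + ε • (1 : Matrix (Fin n) (Fin n) ℂ))

/-- The operator mean `A σ B = lim_{ε ↘ 0} (A + ε I) σ (B + ε I)` of positive semidefinite
matrices, where `h` is the representing function of `σ`. -/
noncomputable def mean (h : ℝ → ℝ) {n : ℕ} (A B : Matrix (Fin n) (Fin n) ℂ) :
    Matrix (Fin n) (Fin n) ℂ :=
  limUnder (𝓝[>] (0 : ℝ)) (shiftedMean h A B)

/-- `(a + ε) σ (b + ε)` for scalars, that is, for `1 × 1` matrices. -/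
noncomputable def shiftedScalarMean (h : ℝ → ℝ) (a b ε : ℝ) : ℝ :=
  (a + ε) * h ((b + ε) / (a + ε))

/-- The mean `a σ b = lim_{ε ↘ 0} (a + ε) σ (b + ε)` of non-negative scalars. -/
noncomputable def scalarMean (h : ℝ → ℝ) (a b : ℝ) : ℝ :=
  limUnder (𝓝[>] (0 : ℝ)) (shiftedScalarMean h a b)

/-- The singular values of `X` in decreasing order with multiplicities, indexed from `0`:
`singVal X j` is `μ_{j+1}(X)`, for `j < n`. -/
noncomputable def singVal {n : ℕ} (X : Matrix (Fin n) (Fin n) ℂ) (j : ℕ) : ℝ :=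
  (Matrix.toEuclideanLin X).singularValues j

/-- The geometric mean `(μ_1(X) ⋯ μ_k(X))^{1/k}` of the `k` largest singular values. -/
noncomputable def topGeom {n : ℕ} (X : Matrix (Fin n) (Fin n) ℂ) (k : ℕ) : ℝ :=
  (∏ j ∈ Finset.range k, singVal X j) ^ ((1 : ℝ) / (k : ℝ))

/-- The geometric mean `(μ_{n+1-k}(X) ⋯ μ_n(X))^{1/k}` of the `k` smallest singular values,
for `1 ≤ k ≤ n`. -/
noncomputable def botGeom {n : ℕ} (X : Matrix (Fin n) (Fin n) ℂ) (k : ℕ) : ℝ :=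
  (∏ j ∈ Finset.Ico (n - k) n, singVal X j) ^ ((1 : ℝ) / (k : ℝ))

end OpMean

namespace OpMean

open Matrix

/-! For invertible `A`, `B` put `C = A^{-1/2} B A^{-1/2}`, so that `A σ B = A^{1/2} h(C) A^{1/2}`.
Let `top` and `bot` denote the products of the `k` largest and `k` smallest singular values. Horn's
inequality `top(S* Y S) ≤ top(S* S) top(Y)`, applied to suitable products and inverses, gives
`top(A) bot(h(C)) ≤ top(A σ B)` and `bot(B) / top(A) ≤ bot(C)`. Since `h` is increasing, the
singular values of `h(C)` are the numbers `h(μ_j(C))`, and geometric convexity (Jensen for `s ↦ log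
h(e^s)`) bounds their geometric mean below by `h` of the geometric mean of the `μ_j(C)`. Chaining
these three facts proves the first inequality of (i); the first inequality of (ii) is the mirror
image, from `bot(A σ B) ≤ bot(A) top(h(C))` and `top(C) ≤ top(B) / bot(A)`. See
`topGeom_mul_le_topGeom_invMean` and `botGeom_invMean_le_botGeom_mul`.

The second inequalities follow by exchanging `A` and `B`, which replaces `h` by `t h(1/t)`
(`invMean_transpose`). This function inherits positivity, monotonicity and the geometric hypothesis,
and the two core lemmas use nothing else.

Singular matrices are reached through `A + ε I`, `B + ε I`. Hansen's inequality
(`IsRepresentingFunction.conj_cfc_le`) makes the mean monotone in its left argument, so the shifted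
means decrease as `ε ↘ 0`. This gives existence of the limits, and the order estimates needed to
pass to them without continuity of `h` or of singular values. -/

/-- The diagonal complex matrix with real entries `d`. -/
noncomputable def rdiag {ι : Type*} [DecidableEq ι] (d : ι → ℝ) : Matrix ι ι ℂ :=
  diagonal fun i => (d i : ℂ)

/-! ### Functional calculus of Hermitian matrices by diagonalization. -/

section cfc

variable {ι : Type*} [DecidableEq ι]

lemma rdiag_isHermitian (d : ι → ℝ) : (rdiag d).IsHermitian := by
  simp [rdiag, Matrix.IsHermitian, diagonal_conjTranspose, Pi.star_def]

lemma conjTranspose_rdiag (d : ι → ℝ) : (rdiag d)ᴴ = rdiag d := rdiag_isHermitian d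

lemma rdiag_one : rdiag (fun _ : ι => (1 : ℝ)) = 1 := by
  simp [rdiag]

lemma rdiag_posSemidef_iff {d : ι → ℝ} : (rdiag d).PosSemidef ↔ ∀ i, 0 ≤ d i := by
  simp [rdiag, posSemidef_diagonal_iff]

variable [Fintype ι]

lemma rdiag_mul (d e : ι → ℝ) : rdiag d * rdiag e = rdiag fun i => d i * e i := by
  simp [rdiag, diagonal_mul_diagonal]

lemma exists_diagonalization {A : Matrix ι ι ℂ} (hA : A.IsHermitian) :
    ∃ (U : Matrix ι ι ℂ) (d : ι → ℝ), Uᴴ * U = 1 ∧ A = U * rdiag d * Uᴴ := by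
  refine ⟨hA.eigenvectorUnitary, hA.eigenvalues, ?_, ?_⟩
  · exact Unitary.coe_star_mul_self hA.eigenvectorUnitary
  · have := hA.spectral_theorem
    rw [Unitary.conjStarAlgAut_apply] at this
    exact this

lemma aeval_conj {U : Matrix ι ι ℂ} (hU : Uᴴ * U = 1) (D : Matrix ι ι ℂ) (p : Polynomial ℝ) :
    Polynomial.aeval (U * D * Uᴴ) p = U * Polynomial.aeval D p * Uᴴ := by
  have hU' : U * Uᴴ = 1 := mul_eq_one_comm.mp hU
  induction p using Polynomial.induction_on' with
  | add p q hp hq => simp [hp, hq, mul_add, add_mul]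
  | monomial n a =>
    have : (U * D * Uᴴ) ^ n = U * D ^ n * Uᴴ := by
      induction n with
      | zero => simp [hU']
      | succ n ih =>
        rw [pow_succ, ih, pow_succ]
        calc U * D ^ n * Uᴴ * (U * D * Uᴴ) = U * D ^ n * (Uᴴ * U) * D * Uᴴ := by
              simp only [mul_assoc]
          _ = _ := by rw [hU, mul_one]; simp only [mul_assoc]
    simp [Polynomial.aeval_monomial, this, Algebra.algebraMap_eq_smul_one]

lemma aeval_rdiag (d : ι → ℝ) (p : Polynomial ℝ) :
    Polynomial.aeval (rdiag d) p = rdiag fun i => p.eval (d i) := by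
  induction p using Polynomial.induction_on' with
  | add p q hp hq =>
    rw [map_add, hp, hq]
    simp [rdiag]
  | monomial n a =>
    have : (rdiag d) ^ n = rdiag fun i => d i ^ n := by
      simp only [rdiag, diagonal_pow]
      congr 1; ext i; simp
    rw [Polynomial.aeval_monomial, this]
    ext i j
    by_cases hij : i = j
    · subst hij; simp [rdiag, Algebra.algebraMap_eq_smul_one]
    · simp [rdiag, Algebra.algebraMap_eq_smul_one, hij]

lemma cfc_eq_aeval {A : Matrix ι ι ℂ} (hA : A.IsHermitian) {f : ℝ → ℝ} {p : Polynomial ℝ}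
    (h : ∀ x ∈ spectrum ℝ A, f x = p.eval x) : cfc f A = Polynomial.aeval A p := by
  rw [cfc_congr (g := p.eval) h, cfc_polynomial p A hA.isSelfAdjoint]

lemma spectrum_conj_rdiag_subset {U : Matrix ι ι ℂ} (hU : Uᴴ * U = 1) (d : ι → ℝ) :
    spectrum ℝ (U * rdiag d * Uᴴ) ⊆ Set.range d := by
  have hU' : U * Uᴴ = 1 := mul_eq_one_comm.mp hU
  intro x hx
  by_contra hne
  have hne' : ∀ i, x - d i ≠ 0 := fun i h => hne ⟨i, by linarith⟩
  apply hx
  rw [spectrum.mem_resolventSet_iff, Matrix.isUnit_iff_isUnit_det]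
  have h1 : algebraMap ℝ (Matrix ι ι ℂ) x - U * rdiag d * Uᴴ
      = U * rdiag (fun i => x - d i) * Uᴴ := by
    have : rdiag (fun i => x - d i) = algebraMap ℝ (Matrix ι ι ℂ) x - rdiag d := by
      ext i j
      by_cases hij : i = j
      · subst hij; simp [rdiag, Algebra.algebraMap_eq_smul_one]
      · simp [rdiag, Algebra.algebraMap_eq_smul_one, hij]
    rw [this, mul_sub, sub_mul, Algebra.algebraMap_eq_smul_one]
    simp [hU']
  rw [h1, det_mul, det_mul, mul_right_comm, ← det_mul, hU', det_one, one_mul, rdiag, det_diagonal,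
    isUnit_iff_ne_zero, Finset.prod_ne_zero_iff]
  intro i _
  exact_mod_cast hne' i

lemma exists_interpolation (f : ℝ → ℝ) {s : Set ℝ} (hs : s.Finite) :
    ∃ p : Polynomial ℝ, ∀ x ∈ s, f x = p.eval x := by
  refine ⟨Lagrange.interpolate hs.toFinset id f, fun x hx => ?_⟩
  have := Lagrange.eval_interpolate_at_node (s := hs.toFinset) (v := id) (i := x) f
    (fun _ _ _ _ h => h) (by simpa using hx)
  simpa using this.symm

/-- On a finite spectrum every `f` agrees with an interpolating polynomial, so no continuity of `f`
is needed. -/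
lemma cfc_conj_rdiag {U : Matrix ι ι ℂ} (hU : Uᴴ * U = 1) (d : ι → ℝ) (f : ℝ → ℝ) :
    cfc f (U * rdiag d * Uᴴ) = U * rdiag (fun i => f (d i)) * Uᴴ := by
  obtain ⟨p, hp⟩ := exists_interpolation f (Set.finite_range d)
  rw [cfc_eq_aeval (isHermitian_mul_mul_conjTranspose U (rdiag_isHermitian d))
    (fun x hx => hp x (spectrum_conj_rdiag_subset hU d hx)), aeval_conj hU, aeval_rdiag]
  congr 3; ext i; exact (hp _ ⟨i, rfl⟩).symm

lemma posSemidef_conj_rdiag_iff {U : Matrix ι ι ℂ} (hU : Uᴴ * U = 1) {d : ι → ℝ} :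
    (U * rdiag d * Uᴴ).PosSemidef ↔ ∀ i, 0 ≤ d i := by
  rw [← rdiag_posSemidef_iff]
  refine ⟨fun h => ?_, fun h => h.mul_mul_conjTranspose_same U⟩
  have := h.conjTranspose_mul_mul_same U
  have e : Uᴴ * (U * rdiag d * Uᴴ) * U = rdiag d := by
    calc _ = (Uᴴ * U) * rdiag d * (Uᴴ * U) := by simp only [mul_assoc]
      _ = _ := by simp [hU]
  rwa [e] at this

lemma cfc_posSemidef {A : Matrix ι ι ℂ} (hA : A.PosSemidef) {f : ℝ → ℝ}
    (hf : ∀ t, 0 ≤ t → 0 ≤ f t) : (cfc f A).PosSemidef := by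
  obtain ⟨U, d, hU, rfl⟩ := exists_diagonalization hA.1
  rw [cfc_conj_rdiag hU, posSemidef_conj_rdiag_iff hU]
  exact fun i => hf _ ((posSemidef_conj_rdiag_iff hU).1 hA i)

lemma cfc_unitary_conj {A W : Matrix ι ι ℂ} (hA : A.IsHermitian) (hW : Wᴴ * W = 1) (f : ℝ → ℝ) :
    cfc f (W * A * Wᴴ) = W * cfc f A * Wᴴ := by
  obtain ⟨U, d, hU, rfl⟩ := exists_diagonalization hA
  have hWU : (W * U)ᴴ * (W * U) = 1 := by
    rw [conjTranspose_mul, mul_assoc, ← mul_assoc Wᴴ, hW, one_mul, hU]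
  have h (D : Matrix ι ι ℂ) : W * (U * D * Uᴴ) * Wᴴ = (W * U) * D * (W * U)ᴴ := by
    simp only [conjTranspose_mul, mul_assoc]
  rw [h, cfc_conj_rdiag hWU, cfc_conj_rdiag hU, h]

lemma cfc_fromBlocks {κ : Type*} [Fintype κ] [DecidableEq κ] {A : Matrix ι ι ℂ}
    {B : Matrix κ κ ℂ} (hA : A.IsHermitian) (hB : B.IsHermitian) (f : ℝ → ℝ) :
    cfc f (fromBlocks A 0 0 B) = fromBlocks (cfc f A) 0 0 (cfc f B) := by
  obtain ⟨U, d, hU, rfl⟩ := exists_diagonalization hA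
  obtain ⟨V, e, hV, rfl⟩ := exists_diagonalization hB
  have hUV : (fromBlocks U 0 0 V)ᴴ * (fromBlocks U 0 0 V) = 1 := by
    simp [fromBlocks_conjTranspose, fromBlocks_multiply, hU, hV, fromBlocks_one]
  have hd (a : ι → ℝ) (b : κ → ℝ) : fromBlocks (U * rdiag a * Uᴴ) 0 0 (V * rdiag b * Vᴴ)
      = fromBlocks U 0 0 V * rdiag (Sum.elim a b) * (fromBlocks U 0 0 V)ᴴ := by
    have : rdiag (Sum.elim a b) = fromBlocks (rdiag a) 0 0 (rdiag b) := by
      rw [rdiag, rdiag, rdiag, fromBlocks_diagonal]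
      congr 1; ext i; cases i <;> rfl
    simp [this, fromBlocks_conjTranspose, fromBlocks_multiply]
  rw [hd, cfc_conj_rdiag hUV, cfc_conj_rdiag hU, cfc_conj_rdiag hV, hd]
  congr 3; ext i; cases i <;> rfl

lemma cfc_submatrix {κ : Type*} [Fintype κ] [DecidableEq κ] {A : Matrix ι ι ℂ}
    (hA : A.IsHermitian) (e : κ ≃ ι) (f : ℝ → ℝ) :
    cfc f (A.submatrix e e) = (cfc f A).submatrix e e := by
  obtain ⟨U, d, hU, rfl⟩ := exists_diagonalization hA
  have hU' : (U.submatrix e e)ᴴ * U.submatrix e e = 1 := by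
    rw [conjTranspose_submatrix, submatrix_mul_equiv, hU, submatrix_one_equiv]
  have h (a : ι → ℝ) : (U * rdiag a * Uᴴ).submatrix e e
      = U.submatrix e e * rdiag (a ∘ e) * (U.submatrix e e)ᴴ := by
    have : rdiag (a ∘ e) = (rdiag a).submatrix e e := by
      rw [rdiag, rdiag, submatrix_diagonal_equiv]; rfl
    rw [this, conjTranspose_submatrix, submatrix_mul_equiv, submatrix_mul_equiv]
  rw [h, cfc_conj_rdiag hU', cfc_conj_rdiag hU, h]
  rfl

/-- Transports the hypothesis from `Fin n` to any finite index type; the block matrices in Hansen's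
inequality are indexed by `ι ⊕ ι`. -/
lemma IsOperatorMonotone.cfc_le_cfc {h : ℝ → ℝ} (hh : IsOperatorMonotone h)
    {A B : Matrix ι ι ℂ} (hA : A.PosSemidef) (hB : B.PosSemidef) (hAB : A ≤ B) :
    cfc h A ≤ cfc h B := by
  let e := (Fintype.equivFin ι).symm
  have := hh _ (A.submatrix e e) (B.submatrix e e) (hA.submatrix e) (hB.submatrix e)
    (Matrix.PosSemidef.submatrix (Matrix.le_iff.1 hAB) e)
  rw [cfc_submatrix hA.1, cfc_submatrix hB.1] at this
  rw [Matrix.le_iff]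
  exact (posSemidef_submatrix_equiv e).1 this

end cfc

/-! ### Hansen's inequality. -/

section hansen

variable {ι : Type*} [Fintype ι]

lemma isClosed_posSemidef : IsClosed {A : Matrix ι ι ℂ | A.PosSemidef} := by
  simp only [posSemidef_iff_dotProduct_mulVec, Set.ofPred_and, Set.ofPred_forall]
  refine IsClosed.inter (isClosed_eq (by fun_prop) (by fun_prop)) (isClosed_iInter fun x => ?_)
  exact isClosed_le continuous_const (by fun_prop)

lemma conj_le_conj {A B : Matrix ι ι ℂ} (h : A ≤ B) (S : Matrix ι ι ℂ) :
    S * A * Sᴴ ≤ S * B * Sᴴ := by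
  rw [Matrix.le_iff] at h ⊢
  have := h.mul_mul_conjTranspose_same S
  rwa [mul_sub, sub_mul] at this

variable [DecidableEq ι]

/-- A form of the Schur bound `[[a, b], [bᴴ, c]] ≤ [[(1+t)a, 0], [0, (1+1/t)c]]`. -/
lemma fromBlocks_conj_le {C S Y : Matrix ι ι ℂ} (hC : C.IsHermitian) (hS : S.IsHermitian)
    (hY : Y.PosSemidef) {t : ℝ} (ht : 0 < t) :
    fromBlocks (C * Y * C) (C * Y * S) (S * Y * C) (S * Y * S) ≤
      fromBlocks ((1 + t) • (C * Y * C)) 0 0 ((1 + t⁻¹) • (S * Y * S)) := by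
  rw [Matrix.le_iff]
  have hYb : (fromBlocks Y 0 0 (0 : Matrix ι ι ℂ)).PosSemidef := by
    have := hY.mul_mul_conjTranspose_same (fromRows (1 : Matrix ι ι ℂ) (0 : Matrix ι ι ℂ))
    rw [conjTranspose_fromRows_eq_fromCols_conjTranspose, fromRows_mul, fromRows_mul_fromCols] at this
    simpa using this
  -- The difference of the two sides is `X Y X*` with the block column `X = (√t C, -S/√t)`; the zero
  -- blocks make it square.
  have h := hYb.mul_mul_conjTranspose_same (fromBlocks (√t • C) 0 (-((√t)⁻¹ • S)) 0)
  have h1 : √t * √t = t := Real.mul_self_sqrt ht.le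
  have h0 : √t ≠ 0 := (Real.sqrt_pos.2 ht).ne'
  have h2 : (√t)⁻¹ * (√t)⁻¹ = t⁻¹ := by rw [← mul_inv, h1]
  suffices e : fromBlocks ((1 + t) • (C * Y * C)) 0 0 ((1 + t⁻¹) • (S * Y * S)) -
      fromBlocks (C * Y * C) (C * Y * S) (S * Y * C) (S * Y * S) =
      fromBlocks (√t • C) 0 (-((√t)⁻¹ • S)) 0 * fromBlocks Y 0 0 (0 : Matrix ι ι ℂ) *
        (fromBlocks (√t • C) 0 (-((√t)⁻¹ • S)) 0)ᴴ by rw [e]; exact h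
  simp only [fromBlocks_conjTranspose, fromBlocks_multiply, conjTranspose_smul, conjTranspose_neg,
    hC.eq, hS.eq, star_trivial, conjTranspose_zero, mul_zero, add_zero, smul_mul_assoc,
    mul_smul_comm, smul_smul, neg_mul, mul_neg, smul_neg, neg_neg, h1, h2, mul_inv_cancel₀ h0,
    inv_mul_cancel₀ h0, one_smul, sub_eq_add_neg, fromBlocks_neg, fromBlocks_add, zero_add]
  congr 1 <;> simp [add_smul]

/-- `C` is dilated to the unitary `J = [[C, S], [S, -C]]` with `S = √(1 - C²)`. The Schur bound
dominates `J diag(Y, 0) J*` by a block diagonal matrix; applying `h` and comparing upper left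
corners gives `C h(Y) C + S h(0) S ≤ h((1 + t) C Y C)`, where `S h(0) S ≥ 0` can be dropped. -/
lemma IsRepresentingFunction.conj_cfc_le_aux {h : ℝ → ℝ} (hh : IsRepresentingFunction h)
    {C Y : Matrix ι ι ℂ} (hC : C.IsHermitian) (hC1 : C * C ≤ 1) (hY : Y.PosSemidef)
    {t : ℝ} (ht : 0 < t) : C * cfc h Y * C ≤ cfc h ((1 + t) • (C * Y * C)) := by
  obtain ⟨U, c, hU, hCU⟩ := exists_diagonalization hC
  have hU' : U * Uᴴ = 1 := mul_eq_one_comm.mp hU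
  have conj_mul (a b : ι → ℝ) : (U * rdiag a * Uᴴ) * (U * rdiag b * Uᴴ)
      = U * rdiag (fun i => a i * b i) * Uᴴ := by
    rw [← rdiag_mul]
    calc _ = U * rdiag a * (Uᴴ * U) * rdiag b * Uᴴ := by simp only [mul_assoc]
      _ = _ := by rw [hU, mul_one]; simp only [mul_assoc]
  have hc : ∀ i, 0 ≤ 1 - c i * c i := by
    rw [← posSemidef_conj_rdiag_iff hU]
    have e : U * rdiag (fun i => 1 - c i * c i) * Uᴴ = 1 - C * C := by
      have : rdiag (fun i => 1 - c i * c i) = 1 - rdiag (fun i => c i * c i) := by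
        rw [← rdiag_one]; simp only [rdiag, diagonal_sub]; congr 1; ext i; push_cast; ring
      rw [this, hCU, conj_mul, mul_sub, sub_mul, mul_one, hU']
    rw [e]; exact Matrix.le_iff.1 hC1
  set S := U * rdiag (fun i => √(1 - c i * c i)) * Uᴴ with hSdef
  have hS : S.IsHermitian := isHermitian_mul_mul_conjTranspose U (rdiag_isHermitian _)
  have hCS : C * S = S * C := by
    rw [hCU, hSdef, conj_mul, conj_mul]
    congr 3; ext i; ring
  have hsum : C * C + S * S = 1 := by
    rw [hCU, hSdef, conj_mul, conj_mul, ← add_mul, ← mul_add]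
    have : (rdiag fun i => c i * c i) + (rdiag fun i => √(1 - c i * c i) * √(1 - c i * c i)) = 1 := by
      rw [← rdiag_one]
      simp only [rdiag, diagonal_add]
      congr 1; ext i
      rw [Real.mul_self_sqrt (hc i)]; push_cast; ring
    rw [this, mul_one, hU']
  set J := fromBlocks C S S (-C) with hJ
  have hJH : Jᴴ = J := by
    simp [hJ, fromBlocks_conjTranspose, hC.eq, hS.eq]
  have hJJ : Jᴴ * J = 1 := by
    rw [hJH, hJ, fromBlocks_multiply, ← fromBlocks_one]
    congr 1
    · simp [hCS]
    · simp [hCS]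
    · simp [add_comm, hsum]
  have hconj (X Z : Matrix ι ι ℂ) : J * fromBlocks X 0 0 Z * Jᴴ = fromBlocks
      (C * X * C + S * Z * S) (C * X * S - S * Z * C) (S * X * C - C * Z * S)
      (S * X * S + C * Z * C) := by
    rw [hJH, hJ, fromBlocks_multiply, fromBlocks_multiply]
    simp [sub_eq_add_neg]
  have hle := fromBlocks_conj_le hC hS hY ht
  have hYJ : fromBlocks (C * Y * C) (C * Y * S) (S * Y * C) (S * Y * S)
      = J * fromBlocks Y 0 0 0 * Jᴴ := by
    rw [hconj]; simp
  have hCYC : ((1 + t) • (C * Y * C)).PosSemidef := by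
    have := hY.mul_mul_conjTranspose_same C
    rw [hC.eq] at this
    exact this.smul (by positivity)
  have hSYS : ((1 + t⁻¹) • (S * Y * S)).PosSemidef := by
    have := hY.mul_mul_conjTranspose_same S
    rw [hS.eq] at this
    exact this.smul (by positivity)
  have hblock {X Z : Matrix ι ι ℂ} (hX : X.PosSemidef) (hZ : Z.PosSemidef) :
      (fromBlocks X 0 0 Z).PosSemidef := by
    obtain ⟨P, rfl⟩ := (CStarAlgebra.nonneg_iff_eq_star_mul_self).1 hX.nonneg
    obtain ⟨Q, rfl⟩ := (CStarAlgebra.nonneg_iff_eq_star_mul_self).1 hZ.nonneg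
    have := posSemidef_conjTranspose_mul_self (fromBlocks P 0 0 Q)
    simpa [fromBlocks_conjTranspose, fromBlocks_multiply, star_eq_conjTranspose] using this
  have hY0 : (fromBlocks Y 0 0 (0 : Matrix ι ι ℂ)).PosSemidef := hblock hY .zero
  rw [hYJ] at hle
  have key := hh.operatorMonotone.cfc_le_cfc (hY0.mul_mul_conjTranspose_same J)
    (hblock hCYC hSYS) hle
  rw [cfc_unitary_conj hY0.1 hJJ, cfc_fromBlocks hY.1 isHermitian_zero, hconj,
    cfc_fromBlocks hCYC.1 hSYS.1, Matrix.le_iff] at key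
  have key' := key.submatrix Sum.inl
  have h0 : (S * cfc h (0 : Matrix ι ι ℂ) * S).PosSemidef := by
    have := (cfc_posSemidef (A := (0 : Matrix ι ι ℂ)) .zero hh.nonneg).mul_mul_conjTranspose_same S
    rwa [hS.eq] at this
  rw [Matrix.le_iff]
  convert key'.add h0 using 1
  ext i j
  simp only [Matrix.sub_apply, Matrix.add_apply, submatrix_apply, fromBlocks_apply₁₁]
  ring

/-- Hansen's inequality for a Hermitian contraction. -/
lemma IsRepresentingFunction.conj_cfc_le {h : ℝ → ℝ} (hh : IsRepresentingFunction h)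
    {C Y : Matrix ι ι ℂ} (hC : C.IsHermitian) (hC1 : C * C ≤ 1) (hY : Y.PosSemidef) :
    C * cfc h Y * C ≤ cfc h (C * Y * C) := by
  -- `h` is not known to be continuous, so the factor `1 + t` is moved out of its argument: the
  -- auxiliary bound for `(1 + t)^{-1/2} C` reads `(1 + t)⁻¹ C h(Y) C ≤ h(C Y C)`, and only the left
  -- side depends on `t`.
  have hT : Tendsto (fun t : ℝ => cfc h (C * Y * C) - (1 + t)⁻¹ • (C * cfc h Y * C)) (𝓝[>] 0)
      (𝓝 (cfc h (C * Y * C) - C * cfc h Y * C)) := by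
    have : Tendsto (fun t : ℝ => (1 + t)⁻¹) (𝓝[>] 0) (𝓝 1) := by
      have : ContinuousAt (fun t : ℝ => (1 + t)⁻¹) 0 := by
        apply ContinuousAt.inv₀ (by fun_prop) (by simp)
      have := this.tendsto.mono_left (nhdsWithin_le_nhds (s := Set.Ioi 0))
      simpa using this
    simpa using (tendsto_const_nhds (x := cfc h (C * Y * C))).sub
      (this.smul_const (C * cfc h Y * C))
  refine Matrix.le_iff.2 (isClosed_posSemidef.mem_of_tendsto hT ?_)
  filter_upwards [self_mem_nhdsWithin] with t (ht : 0 < t)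
  have ht1 : (0 : ℝ) < 1 + t := by linarith
  set s := (√(1 + t))⁻¹
  have hss : s * s = (1 + t)⁻¹ := by rw [← mul_inv, Real.mul_self_sqrt ht1.le]
  have hCs : (s • C).IsHermitian := hC.smul (IsSelfAdjoint.all _)
  have hCC : (C * C).PosSemidef := by
    have := posSemidef_conjTranspose_mul_self C
    rwa [hC.eq] at this
  have hle : (s • C) * (s • C) ≤ 1 := by
    rw [smul_mul_smul_comm, hss]
    refine le_trans ?_ hC1
    rw [Matrix.le_iff]
    have : C * C - (1 + t)⁻¹ • (C * C) = (1 - (1 + t)⁻¹) • (C * C) := by rw [sub_smul, one_smul]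
    rw [this]
    refine hCC.smul ?_
    rw [sub_nonneg]
    exact inv_le_one_of_one_le₀ (by linarith)
  have := hh.conj_cfc_le_aux hCs hle hY ht
  simp only [smul_mul_assoc, mul_smul_comm, smul_smul] at this
  rw [hss, mul_inv_cancel₀ ht1.ne', one_smul] at this
  exact Matrix.le_iff.1 this

end hansen

/-! ### Square roots of positive matrices. -/

section sqrt

variable {ι : Type*} [Fintype ι] [DecidableEq ι]

lemma sqrt_posSemidef (A : Matrix ι ι ℂ) : (CFC.sqrt A).PosSemidef :=
  Matrix.nonneg_iff_posSemidef.1 (CFC.sqrt_nonneg A)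

lemma sqrt_mul_sqrt {A : Matrix ι ι ℂ} (hA : A.PosSemidef) : CFC.sqrt A * CFC.sqrt A = A :=
  CFC.sqrt_mul_sqrt_self A hA.nonneg

lemma isUnit_det_sqrt {A : Matrix ι ι ℂ} (hA : A.PosDef) : IsUnit (CFC.sqrt A).det := by
  have h : (CFC.sqrt A).det * (CFC.sqrt A).det = A.det := by
    rw [← det_mul, sqrt_mul_sqrt hA.posSemidef]
  have := (Matrix.isUnit_iff_isUnit_det A).1 hA.isUnit
  rw [← h] at this
  exact isUnit_of_mul_isUnit_left this

lemma sqrt_posDef {A : Matrix ι ι ℂ} (hA : A.PosDef) : (CFC.sqrt A).PosDef :=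
  (sqrt_posSemidef A).posDef_iff_isUnit.2 ((Matrix.isUnit_iff_isUnit_det _).2 (isUnit_det_sqrt hA))

lemma inv_sqrt_mul {A : Matrix ι ι ℂ} (hA : A.PosDef) : (CFC.sqrt A)⁻¹ * CFC.sqrt A = 1 :=
  nonsing_inv_mul _ (isUnit_det_sqrt hA)

lemma sqrt_mul_inv {A : Matrix ι ι ℂ} (hA : A.PosDef) : CFC.sqrt A * (CFC.sqrt A)⁻¹ = 1 :=
  mul_nonsing_inv _ (isUnit_det_sqrt hA)

lemma conjTranspose_sqrt (A : Matrix ι ι ℂ) : (CFC.sqrt A)ᴴ = CFC.sqrt A :=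
  (sqrt_posSemidef A).1

lemma conjTranspose_inv_sqrt (A : Matrix ι ι ℂ) : ((CFC.sqrt A)⁻¹)ᴴ = (CFC.sqrt A)⁻¹ :=
  (sqrt_posSemidef A).1.inv

lemma posSemidef_inv_sqrt_conj {A B : Matrix ι ι ℂ} (hB : B.PosSemidef) :
    ((CFC.sqrt A)⁻¹ * B * (CFC.sqrt A)⁻¹).PosSemidef := by
  have := hB.mul_mul_conjTranspose_same (CFC.sqrt A)⁻¹
  rwa [conjTranspose_inv_sqrt] at this

lemma posDef_inv_sqrt_conj {A B : Matrix ι ι ℂ} (hA : A.PosDef) (hB : B.PosDef) :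
    ((CFC.sqrt A)⁻¹ * B * (CFC.sqrt A)⁻¹).PosDef := by
  refine (posSemidef_inv_sqrt_conj hB.posSemidef).posDef_iff_isUnit.2 ?_
  have h : IsUnit (CFC.sqrt A)⁻¹ := (sqrt_posDef hA).inv.isUnit
  exact (h.mul hB.isUnit).mul h

/-- In a product, cancel `X * Y = 1` in front of a further factor. -/
lemma mul_cancel_left {X Y : Matrix ι ι ℂ} (h : X * Y = 1) (Z : Matrix ι ι ℂ) : X * (Y * Z) = Z := by
  rw [← mul_assoc, h, one_mul]

end sqrt

/-! ### The mean of invertible matrices: monotonicity and transposition. -/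

section invMean

variable {n : ℕ}

/-- The mean can be computed from any square root `S * Sᴴ = A`. -/
lemma invMean_eq_of_root (h : ℝ → ℝ) {A B S T : Matrix (Fin n) (Fin n) ℂ} (hA : A.PosDef)
    (hB : B.IsHermitian) (hS : S * Sᴴ = A) (hTS : T * S = 1) :
    invMean h A B = S * cfc h (T * B * Tᴴ) * Sᴴ := by
  set R := CFC.sqrt A with hR
  have hRR : R * R = A := sqrt_mul_sqrt hA.posSemidef
  have hiR : R⁻¹ * R = 1 := inv_sqrt_mul hA
  have hRi : R * R⁻¹ = 1 := sqrt_mul_inv hA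
  have hRH : Rᴴ = R := conjTranspose_sqrt A
  have hRiH : (R⁻¹)ᴴ = R⁻¹ := conjTranspose_inv_sqrt A
  -- Two roots of `A` differ by a unitary: `S = R W`. Since `T = W* R⁻¹`, the functional calculus
  -- absorbs `W`.
  obtain ⟨W, hW⟩ : ∃ W, W = R⁻¹ * S := ⟨_, rfl⟩
  have hWW : W * Wᴴ = 1 := by
    rw [hW, conjTranspose_mul, hRiH]
    calc R⁻¹ * S * (Sᴴ * R⁻¹) = R⁻¹ * (S * Sᴴ) * R⁻¹ := by simp only [mul_assoc]
      _ = (R⁻¹ * R) * (R * R⁻¹) := by rw [hS, ← hRR]; simp only [mul_assoc]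
      _ = 1 := by rw [hiR, hRi, one_mul]
  have hWW' : Wᴴ * W = 1 := mul_eq_one_comm.mp hWW
  have hSW : S = R * W := by rw [hW, mul_cancel_left hRi]
  have hT : T = Wᴴ * R⁻¹ := by
    have : Wᴴ * R⁻¹ * S = 1 := by rw [mul_assoc, ← hW, hWW']
    have hST : S * T = 1 := mul_eq_one_comm.mp hTS
    calc T = (Wᴴ * R⁻¹ * S) * T := by rw [this, one_mul]
      _ = Wᴴ * R⁻¹ := by rw [mul_assoc, hST, mul_one]
  have hN : (R⁻¹ * B * R⁻¹).IsHermitian := by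
    have := isHermitian_mul_mul_conjTranspose R⁻¹ hB
    rwa [hRiH] at this
  have hTB : T * B * Tᴴ = Wᴴ * (R⁻¹ * B * R⁻¹) * Wᴴᴴ := by
    rw [hT, conjTranspose_mul, hRiH]; simp only [mul_assoc]
  rw [hTB, cfc_unitary_conj hN (by rw [conjTranspose_conjTranspose, hWW]), hSW, conjTranspose_mul,
    hRH, conjTranspose_conjTranspose, invMean, ← hR]
  simp only [mul_assoc]
  rw [mul_cancel_left hWW, mul_cancel_left hWW]

lemma invMean_posSemidef {h : ℝ → ℝ} (hh : ∀ t, 0 ≤ t → 0 ≤ h t) {A B : Matrix (Fin n) (Fin n) ℂ}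
    (hB : B.PosSemidef) : (invMean h A B).PosSemidef := by
  have := (cfc_posSemidef (posSemidef_inv_sqrt_conj (A := A) hB) hh).mul_mul_conjTranspose_same
    (CFC.sqrt A)
  rwa [conjTranspose_sqrt] at this

lemma IsRepresentingFunction.invMean_mono_right {h : ℝ → ℝ} (hh : IsRepresentingFunction h)
    {A B B' : Matrix (Fin n) (Fin n) ℂ} (hB : B.PosSemidef) (hB' : B'.PosSemidef) (hBB : B ≤ B') :
    invMean h A B ≤ invMean h A B' := by
  have h1 := conj_le_conj hBB (CFC.sqrt A)⁻¹
  rw [conjTranspose_inv_sqrt] at h1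
  have h2 := conj_le_conj (hh.operatorMonotone.cfc_le_cfc (posSemidef_inv_sqrt_conj hB)
    (posSemidef_inv_sqrt_conj hB') h1) (CFC.sqrt A)
  rwa [conjTranspose_sqrt] at h2

/-- With `R = A'^{1/2}`, the matrix `C = (R⁻¹ A R⁻¹)^{1/2}` is a contraction and `R C` is a root of
`A`. For `N = R⁻¹ B R⁻¹` this gives `A σ B = R C h(C⁻¹ N C⁻¹) C R`, which is at most `R h(N) R = A'
σ B` by Hansen's inequality. -/
lemma IsRepresentingFunction.invMean_mono_left {h : ℝ → ℝ} (hh : IsRepresentingFunction h)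
    {A A' B : Matrix (Fin n) (Fin n) ℂ} (hA : A.PosDef) (hA' : A'.PosDef) (hAA : A ≤ A')
    (hB : B.PosSemidef) : invMean h A B ≤ invMean h A' B := by
  set R := CFC.sqrt A' with hR
  have hRR : R * R = A' := sqrt_mul_sqrt hA'.posSemidef
  have hiR : R⁻¹ * R = 1 := inv_sqrt_mul hA'
  have hRi : R * R⁻¹ = 1 := sqrt_mul_inv hA'
  have hRH : Rᴴ = R := conjTranspose_sqrt A'
  have hRiH : (R⁻¹)ᴴ = R⁻¹ := conjTranspose_inv_sqrt A'
  have hG : (R⁻¹ * A * R⁻¹).PosDef := posDef_inv_sqrt_conj hA' hA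
  set C := CFC.sqrt (R⁻¹ * A * R⁻¹) with hC
  have hCC : C * C = R⁻¹ * A * R⁻¹ := sqrt_mul_sqrt hG.posSemidef
  have hiC : C⁻¹ * C = 1 := inv_sqrt_mul hG
  have hCi : C * C⁻¹ = 1 := sqrt_mul_inv hG
  have hCH : Cᴴ = C := conjTranspose_sqrt _
  have hCiH : (C⁻¹)ᴴ = C⁻¹ := conjTranspose_inv_sqrt _
  have hC1 : C * C ≤ 1 := by
    have := conj_le_conj hAA R⁻¹
    rw [hRiH] at this
    rw [hCC]
    refine this.trans_eq ?_
    rw [← hRR, ← mul_assoc, hiR, one_mul, hRi]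
  have hroot : (R * C) * (R * C)ᴴ = A := by
    rw [conjTranspose_mul, hRH, hCH]
    calc R * C * (C * R) = R * (C * C) * R := by simp only [mul_assoc]
      _ = (R * R⁻¹) * A * (R⁻¹ * R) := by rw [hCC]; simp only [mul_assoc]
      _ = A := by rw [hRi, hiR, one_mul, mul_one]
  have hinv : (C⁻¹ * R⁻¹) * (R * C) = 1 := by
    rw [mul_assoc, mul_cancel_left hiR, hiC]
  rw [invMean_eq_of_root h hA hB.1 hroot hinv, invMean, ← hR]
  have hN : (R⁻¹ * B * R⁻¹).PosSemidef := posSemidef_inv_sqrt_conj hB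
  set N := R⁻¹ * B * R⁻¹ with hNdef
  have hY : (C⁻¹ * N * C⁻¹).PosSemidef := posSemidef_inv_sqrt_conj hN
  have key := conj_le_conj (hh.conj_cfc_le hCH hC1 hY) R
  have e1 : C * (C⁻¹ * N * C⁻¹) * C = N := by
    simp only [mul_assoc]
    rw [mul_cancel_left hCi, hiC, mul_one]
  have e2 : C⁻¹ * R⁻¹ * B * (C⁻¹ * R⁻¹)ᴴ = C⁻¹ * N * C⁻¹ := by
    rw [conjTranspose_mul, hRiH, hCiH, hNdef]; simp only [mul_assoc]
  rw [e1, hRH] at key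
  rw [e2, conjTranspose_mul, hRH, hCH]
  refine le_trans (le_of_eq ?_) key
  simp only [mul_assoc]

lemma IsRepresentingFunction.invMean_mono {h : ℝ → ℝ} (hh : IsRepresentingFunction h)
    {A A' B B' : Matrix (Fin n) (Fin n) ℂ} (hA : A.PosDef) (hA' : A'.PosDef) (hAA : A ≤ A')
    (hB : B.PosSemidef) (hB' : B'.PosSemidef) (hBB : B ≤ B') : invMean h A B ≤ invMean h A' B' :=
  (hh.invMean_mono_left hA hA' hAA hB).trans (hh.invMean_mono_right hB hB' hBB)

/-- The representing function of the transposed mean `(A, B) ↦ B σ A`. -/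
noncomputable def transposeFun (h : ℝ → ℝ) (t : ℝ) : ℝ := t * h t⁻¹

/-- With `R = B^{1/2}` and `G = R⁻¹ A R⁻¹`, the root `R G^{1/2}` of `A` yields `A σ B = R G^{1/2}
h(G⁻¹) G^{1/2} R = R (G h(G⁻¹)) R`. All factors in the middle are diagonal in one eigenbasis of `G`.
-/
lemma invMean_transpose (h : ℝ → ℝ) {A B : Matrix (Fin n) (Fin n) ℂ} (hA : A.PosDef)
    (hB : B.PosDef) : invMean h A B = invMean (transposeFun h) B A := by
  set R := CFC.sqrt B with hR
  have hRR : R * R = B := sqrt_mul_sqrt hB.posSemidef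
  have hiR : R⁻¹ * R = 1 := inv_sqrt_mul hB
  have hRi : R * R⁻¹ = 1 := sqrt_mul_inv hB
  have hRH : Rᴴ = R := conjTranspose_sqrt B
  have hRiH : (R⁻¹)ᴴ = R⁻¹ := conjTranspose_inv_sqrt B
  have hG : (R⁻¹ * A * R⁻¹).PosDef := posDef_inv_sqrt_conj hB hA
  obtain ⟨U, g, hU, hUg⟩ := exists_diagonalization hG.1
  have hU' : U * Uᴴ = 1 := mul_eq_one_comm.mp hU
  have hg0 : ∀ i, 0 ≤ g i := by
    rw [← posSemidef_conj_rdiag_iff hU, ← hUg]; exact hG.posSemidef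
  have hg : ∀ i, 0 < g i := by
    have hdet : IsUnit (U * rdiag g * Uᴴ).det :=
      (Matrix.isUnit_iff_isUnit_det _).1 (hUg ▸ hG.isUnit)
    rw [det_mul, det_mul, mul_right_comm, ← det_mul, hU', det_one, one_mul, rdiag, det_diagonal,
      isUnit_iff_ne_zero, Finset.prod_ne_zero_iff] at hdet
    exact fun i => lt_of_le_of_ne (hg0 i) fun h => hdet i (Finset.mem_univ i) (by simp [← h])
  have hs : ∀ i, √(g i) ≠ 0 := fun i => (Real.sqrt_pos.2 (hg i)).ne'
  have conj_mul (a b : Fin n → ℝ) : (U * rdiag a * Uᴴ) * (U * rdiag b * Uᴴ)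
      = U * rdiag (fun i => a i * b i) * Uᴴ := by
    rw [← rdiag_mul]
    calc _ = U * rdiag a * (Uᴴ * U) * rdiag b * Uᴴ := by simp only [mul_assoc]
      _ = _ := by rw [hU, mul_one]; simp only [mul_assoc]
  have conjH (a : Fin n → ℝ) : (U * rdiag a * Uᴴ)ᴴ = U * rdiag a * Uᴴ :=
    isHermitian_mul_mul_conjTranspose U (rdiag_isHermitian a)
  set Q := U * rdiag (fun i => √(g i)) * Uᴴ with hQ
  set P := U * rdiag (fun i => (√(g i))⁻¹) * Uᴴ with hP
  have hQQ : Q * Q = R⁻¹ * A * R⁻¹ := by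
    rw [hUg, hQ, conj_mul]; congr 3; ext i; exact Real.mul_self_sqrt (hg0 i)
  have hPQ : P * Q = 1 := by
    rw [hP, hQ, conj_mul]
    simp only [inv_mul_cancel₀ (hs _), rdiag_one, mul_one, hU']
  have hroot : (R * Q) * (R * Q)ᴴ = A := by
    rw [conjTranspose_mul, hRH, conjH]
    calc R * Q * (Q * R) = R * (Q * Q) * R := by simp only [mul_assoc]
      _ = (R * R⁻¹) * A * (R⁻¹ * R) := by rw [hQQ]; simp only [mul_assoc]
      _ = A := by rw [hRi, hiR, one_mul, mul_one]
  have hinv : (P * R⁻¹) * (R * Q) = 1 := by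
    rw [mul_assoc, mul_cancel_left hiR, hPQ]
  have hPP : P * R⁻¹ * B * (P * R⁻¹)ᴴ = U * rdiag (fun i => (g i)⁻¹) * Uᴴ := by
    rw [conjTranspose_mul, hRiH, conjH]
    calc P * R⁻¹ * B * (R⁻¹ * P) = P * (R⁻¹ * R) * (R * R⁻¹) * P := by
          rw [← hRR]; simp only [mul_assoc]
      _ = P * P := by rw [hiR, hRi, mul_one, mul_one]
      _ = _ := by
          rw [hP, conj_mul]; congr 3; ext i
          rw [← mul_inv, Real.mul_self_sqrt (hg0 i)]
  rw [invMean_eq_of_root h hA hB.1 hroot hinv, hPP, cfc_conj_rdiag hU, invMean, ← hR, hUg,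
    cfc_conj_rdiag hU, conjTranspose_mul, conjH, hRH]
  calc _ = R * ((U * rdiag (fun i => √(g i)) * Uᴴ) * (U * rdiag (fun i => h (g i)⁻¹) * Uᴴ)
        * (U * rdiag (fun i => √(g i)) * Uᴴ)) * R := by simp only [hQ, mul_assoc]
    _ = _ := by
      rw [conj_mul, conj_mul]
      congr 5; ext i
      rw [transposeFun, mul_right_comm, Real.mul_self_sqrt (hg0 i)]

end invMean

/-! ### Convergence of monotone families of positive matrices. -/

section limits

/-- Each quadratic form is monotone in `t` and bounded below by `0`, hence converges; polarization
recovers the matrix entries. -/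
lemma exists_tendsto_of_monotone_posSemidef {n : ℕ} {M : ℝ → Matrix (Fin n) (Fin n) ℂ}
    (hM : ∀ t, 0 < t → (M t).PosSemidef) (hmono : ∀ s t, 0 < s → s ≤ t → M s ≤ M t) :
    ∃ M₀, Tendsto M (𝓝[>] 0) (𝓝 M₀) := by
  have hq (x : Fin n → ℂ) : ∃ q : ℂ, Tendsto (fun t => star x ⬝ᵥ (M t *ᵥ x)) (𝓝[>] 0) (𝓝 q) := by
    have hmon : MonotoneOn (fun t => (star x ⬝ᵥ (M t *ᵥ x)).re) (Set.Ioi 0) := by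
      intro s hs t _ hst
      have := (Matrix.le_iff.1 (hmono s t hs hst)).dotProduct_mulVec_nonneg x
      rw [sub_mulVec, dotProduct_sub, sub_nonneg] at this
      exact (Complex.le_def.1 this).1
    have hbdd : BddBelow ((fun t => (star x ⬝ᵥ (M t *ᵥ x)).re) '' Set.Ioi 0) := by
      refine ⟨0, ?_⟩
      rintro _ ⟨t, ht, rfl⟩
      exact (Complex.le_def.1 ((hM t ht).dotProduct_mulVec_nonneg x)).1
    have h1 := hmon.tendsto_nhdsGT hbdd
    refine ⟨_, ((Complex.continuous_ofReal.tendsto _).comp h1).congr' ?_⟩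
    filter_upwards [self_mem_nhdsWithin] with t ht
    have := (Complex.le_def.1 ((hM t ht).dotProduct_mulVec_nonneg x)).2
    apply Complex.ext
    · simp
    · simpa using this
  choose q hq using hq
  have hent (A : Matrix (Fin n) (Fin n) ℂ) (i j : Fin n) : A i j =
      (1 / 2) * ((star (Pi.single i 1 + Pi.single j 1) ⬝ᵥ (A *ᵥ (Pi.single i 1 + Pi.single j 1))
        - star (Pi.single i 1) ⬝ᵥ (A *ᵥ Pi.single i 1) - star (Pi.single j 1) ⬝ᵥ (A *ᵥ Pi.single j 1))
      - Complex.I * (star (Pi.single i 1 + Complex.I • Pi.single j 1) ⬝ᵥ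
          (A *ᵥ (Pi.single i 1 + Complex.I • Pi.single j 1))
        - star (Pi.single i 1) ⬝ᵥ (A *ᵥ Pi.single i 1)
        - star (Pi.single j 1) ⬝ᵥ (A *ᵥ Pi.single j 1))) := by
    simp only [star_add, star_smul, mulVec_add, mulVec_smul, dotProduct_add, add_dotProduct,
      smul_dotProduct, dotProduct_smul, Pi.star_single, star_one, single_one_dotProduct,
      mulVec_single_one, Complex.star_def, Complex.conj_I, smul_eq_mul, Matrix.col_apply]
    linear_combination ((1/2) * A i j - (1/2) * A j i - (1/2) * Complex.I * A j j) * Complex.I_sq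
  refine ⟨Matrix.of fun i j => (1 / 2) * ((q (Pi.single i 1 + Pi.single j 1)
        - q (Pi.single i 1) - q (Pi.single j 1))
      - Complex.I * (q (Pi.single i 1 + Complex.I • Pi.single j 1)
        - q (Pi.single i 1) - q (Pi.single j 1))), ?_⟩
  refine tendsto_pi_nhds.2 fun i => tendsto_pi_nhds.2 fun j => ?_
  simp only [hent (M _) i j, Matrix.of_apply]
  exact ((((hq _).sub (hq _)).sub (hq _)).sub ((((hq _).sub (hq _)).sub (hq _)).const_mul _)).const_mul _

end limits

/-! ### Comparison of ordered spectra. -/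

section comparison

lemma dotProduct_rdiag_mulVec {ι : Type*} [Fintype ι] [DecidableEq ι] (d : ι → ℝ) (x : ι → ℂ) :
    star x ⬝ᵥ (rdiag d *ᵥ x) = ((∑ i, d i * Complex.normSq (x i) : ℝ) : ℂ) := by
  simp only [dotProduct, rdiag, mulVec_diagonal, Pi.star_apply, Complex.star_def,
    Complex.ofReal_sum, Complex.ofReal_mul, Complex.normSq_eq_conj_mul_self]
  exact Finset.sum_congr rfl fun i _ => by ring

/-- Comparison of decreasing spectra (Courant–Fischer for a compression by an isometry). -/
lemma le_of_isometry_rdiag {m n : ℕ} {d : Fin m → ℝ} {e : Fin n → ℝ} (hd : Antitone d)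
    (he : Antitone e) {K : Matrix (Fin n) (Fin m) ℂ} (hK : Kᴴ * K = 1)
    (h : (Kᴴ * rdiag e * K - rdiag d).PosSemidef) {j : ℕ} (hm : j < m) (hn : j < n) :
    d ⟨j, hm⟩ ≤ e ⟨j, hn⟩ := by
  -- The kernel of `f` consists of the `x` with `x_i = 0` for `i > j` and `(K x)_i = 0` for `i < j`.
  -- These are `j + (m - 1 - j) = m - 1` conditions on `m` coordinates, so a nonzero `x` exists; it
  -- gives `d_j ‖x‖² ≤ ⟨x, D x⟩ ≤ ⟨K x, E K x⟩ ≤ e_j ‖x‖²`, where `D` and `E` are the diagonal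
  -- matrices of `d` and `e`.
  let f : (Fin m → ℂ) →ₗ[ℂ] (Fin j ⊕ Fin (m - 1 - j) → ℂ) :=
    { toFun := fun x => Sum.elim (fun i => (K *ᵥ x) ⟨i, i.2.trans hn⟩)
        (fun i => x ⟨j + 1 + i, by omega⟩)
      map_add' := by
        intro x y; ext i; cases i <;> simp [mulVec_add]
      map_smul' := by
        intro c x; ext i; cases i <;> simp [mulVec_smul] }
  have hker : LinearMap.ker f ≠ ⊥ := by
    apply LinearMap.ker_ne_bot_of_finrank_lt
    simp only [Module.finrank_fintype_fun_eq_card, Fintype.card_sum, Fintype.card_fin]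
    omega
  obtain ⟨x, hx, hx0⟩ := Submodule.exists_mem_ne_zero_of_ne_bot hker
  have hfx : f x = 0 := hx
  have hxz : ∀ i : Fin m, j < i → x i = 0 := by
    intro i hi
    have := congrFun hfx (Sum.inr ⟨i - (j + 1), by omega⟩)
    simp only [f, LinearMap.coe_mk, AddHom.coe_mk, Sum.elim_inr, Pi.zero_apply] at this
    rw [← this]; congr 1; ext; simp; omega
  have hyz : ∀ i : Fin n, (i : ℕ) < j → (K *ᵥ x) i = 0 := by
    intro i hi
    exact congrFun hfx (Sum.inl ⟨i, hi⟩)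
  set y := K *ᵥ x with hy
  have hnorm : ∑ i, Complex.normSq (y i) = ∑ i, Complex.normSq (x i) := by
    have h1 : star y ⬝ᵥ y = star x ⬝ᵥ x := by
      rw [hy, star_mulVec, ← dotProduct_mulVec, mulVec_mulVec, hK, one_mulVec]
    have h2 {ι : Type} [Fintype ι] (z : ι → ℂ) :
        star z ⬝ᵥ z = ((∑ i, Complex.normSq (z i) : ℝ) : ℂ) := by
      simp [dotProduct, Complex.normSq_eq_conj_mul_self]
    rw [h2, h2] at h1
    exact_mod_cast h1
  have hpos : 0 < ∑ i, Complex.normSq (x i) := by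
    obtain ⟨i, hi⟩ := Function.ne_iff.1 hx0
    exact Finset.sum_pos' (fun i _ => Complex.normSq_nonneg _)
      ⟨i, Finset.mem_univ i, Complex.normSq_pos.2 hi⟩
  have hle : ∑ i, d i * Complex.normSq (x i) ≤ ∑ i, e i * Complex.normSq (y i) := by
    have := h.dotProduct_mulVec_nonneg x
    rw [sub_mulVec, dotProduct_sub, sub_nonneg, dotProduct_rdiag_mulVec, ← mulVec_mulVec,
      ← mulVec_mulVec, dotProduct_mulVec, ← star_mulVec, ← hy, dotProduct_rdiag_mulVec] at this
    exact_mod_cast this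
  have h1 : d ⟨j, hm⟩ * ∑ i, Complex.normSq (x i) ≤ ∑ i, d i * Complex.normSq (x i) := by
    rw [Finset.mul_sum]
    refine Finset.sum_le_sum fun i _ => ?_
    rcases lt_or_ge j (i : ℕ) with hi | hi
    · simp [hxz i hi]
    · exact mul_le_mul_of_nonneg_right (hd (by exact hi)) (Complex.normSq_nonneg _)
  have h2 : ∑ i, e i * Complex.normSq (y i) ≤ e ⟨j, hn⟩ * ∑ i, Complex.normSq (y i) := by
    rw [Finset.mul_sum]
    refine Finset.sum_le_sum fun i _ => ?_
    rcases lt_or_ge (i : ℕ) j with hi | hi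
    · simp [hyz i hi]
    · exact mul_le_mul_of_nonneg_right (he (by exact hi)) (Complex.normSq_nonneg _)
  rw [hnorm] at h2
  exact le_of_mul_le_mul_right (h1.trans (hle.trans h2)) hpos

lemma le_of_isometry_conj {m n : ℕ} {d : Fin m → ℝ} {e : Fin n → ℝ} (hd : Antitone d)
    (he : Antitone e) {U : Matrix (Fin m) (Fin m) ℂ} {V : Matrix (Fin n) (Fin n) ℂ}
    {W : Matrix (Fin n) (Fin m) ℂ} (hU : Uᴴ * U = 1) (hV : Vᴴ * V = 1) (hW : Wᴴ * W = 1)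
    (h : (Wᴴ * (V * rdiag e * Vᴴ) * W - U * rdiag d * Uᴴ).PosSemidef) {j : ℕ} (hm : j < m)
    (hn : j < n) : d ⟨j, hm⟩ ≤ e ⟨j, hn⟩ := by
  have hV' : V * Vᴴ = 1 := mul_eq_one_comm.mp hV
  refine le_of_isometry_rdiag hd he (K := Vᴴ * W * U) ?_ ?_ hm hn
  · simp only [conjTranspose_mul, conjTranspose_conjTranspose]
    calc _ = Uᴴ * (Wᴴ * (V * Vᴴ) * W) * U := by simp only [Matrix.mul_assoc]
      _ = 1 := by rw [hV', Matrix.mul_one, hW, Matrix.mul_one, hU]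
  · have := h.conjTranspose_mul_mul_same U
    convert this using 1
    simp only [conjTranspose_mul, conjTranspose_conjTranspose, Matrix.mul_sub, Matrix.sub_mul]
    congr 1
    · simp only [Matrix.mul_assoc]
    · calc _ = (Uᴴ * U) * rdiag d * (Uᴴ * U) := by rw [hU, Matrix.mul_one, Matrix.one_mul]
        _ = _ := by simp only [Matrix.mul_assoc]

end comparison

/-! ### Singular values of positive semidefinite matrices. -/

section singVal

variable {n : ℕ}

lemma conj_rdiag_permute (U : Matrix (Fin n) (Fin n) ℂ) (d : Fin n → ℝ) (σ : Equiv.Perm (Fin n)) :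
    U.submatrix id σ * rdiag (d ∘ σ) * (U.submatrix id σ)ᴴ = U * rdiag d * Uᴴ := by
  have : rdiag (d ∘ σ) = (rdiag d).submatrix σ σ := by
    rw [rdiag, rdiag, submatrix_diagonal_equiv]; rfl
  rw [this, conjTranspose_submatrix, submatrix_mul_equiv, submatrix_mul_equiv, submatrix_id_id]

lemma submatrix_isometry {U : Matrix (Fin n) (Fin n) ℂ} (hU : Uᴴ * U = 1) {k : ℕ} {f : Fin k → Fin n}
    (hf : Function.Injective f) : (U.submatrix id f)ᴴ * U.submatrix id f = 1 := by
  have : (U.submatrix id f)ᴴ * U.submatrix id f = (Uᴴ * U).submatrix f f := by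
    ext a b
    simp [Matrix.mul_apply]
  rw [this, hU, submatrix_one _ hf]

lemma exists_diagonalization_eigenvalues₀ {A : Matrix (Fin n) (Fin n) ℂ} (hA : A.IsHermitian) :
    ∃ U : Matrix (Fin n) (Fin n) ℂ, Uᴴ * U = 1 ∧
      A = U * rdiag (fun i => hA.eigenvalues₀ (Fin.cast (Fintype.card_fin n).symm i)) * Uᴴ := by
  -- `eigenvalues` is the ordered list `eigenvalues₀` reindexed by an unspecified bijection; `σ`
  -- undoes it.
  let σ : Equiv.Perm (Fin n) := (finCongr (Fintype.card_fin n).symm).trans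
    (Fintype.equivOfCardEq (Fintype.card_fin _))
  have hU : (hA.eigenvectorUnitary : Matrix (Fin n) (Fin n) ℂ)ᴴ * hA.eigenvectorUnitary = 1 :=
    Unitary.coe_star_mul_self hA.eigenvectorUnitary
  refine ⟨(hA.eigenvectorUnitary : Matrix (Fin n) (Fin n) ℂ).submatrix id σ,
    submatrix_isometry hU σ.injective, ?_⟩
  have h := hA.spectral_theorem
  rw [Unitary.conjStarAlgAut_apply] at h
  have e : (fun i => hA.eigenvalues₀ (Fin.cast (Fintype.card_fin n).symm i)) = hA.eigenvalues ∘ σ := by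
    ext i; simp [σ, IsHermitian.eigenvalues]
  rw [e, conj_rdiag_permute]
  exact h

lemma singVal_eq_sqrt_eigenvalues₀ (X : Matrix (Fin n) (Fin n) ℂ) (j : Fin n) :
    singVal X j = √((isHermitian_conjTranspose_mul_self X).eigenvalues₀
      (Fin.cast (Fintype.card_fin n).symm j)) := by
  have aux {T T' : EuclideanSpace ℂ (Fin n) →ₗ[ℂ] EuclideanSpace ℂ (Fin n)} (hT : T.IsSymmetric)
      (hT' : T'.IsSymmetric) (h : T = T') {a : ℕ}
      (ha : Module.finrank ℂ (EuclideanSpace ℂ (Fin n)) = a) (i : Fin a) :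
      hT.eigenvalues ha i = hT'.eigenvalues ha i := by subst h; rfl
  have hfin : Module.finrank ℂ (EuclideanSpace ℂ (Fin n)) = Fintype.card (Fin n) :=
    finrank_euclideanSpace
  have h := (Matrix.toEuclideanLin X).singularValues_fin hfin
    (Fin.cast (Fintype.card_fin n).symm j)
  rw [Fin.val_cast] at h
  rw [singVal, h, IsHermitian.eigenvalues₀]
  congr 1
  apply aux
  rw [← Matrix.toEuclideanLin_conjTranspose_eq_adjoint]
  ext x
  simp [Matrix.toLpLin_apply, mulVec_mulVec]

/-- Two decreasing diagonalizations of `A* A` have the same diagonal, by the spectral comparison in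
both directions with `W = 1`. -/
lemma singVal_eq_of_conj_rdiag {U : Matrix (Fin n) (Fin n) ℂ} (hU : Uᴴ * U = 1) {d : Fin n → ℝ}
    (hd : Antitone d) (hd0 : ∀ i, 0 ≤ d i) (j : Fin n) :
    singVal (U * rdiag d * Uᴴ) j = d j := by
  set A := U * rdiag d * Uᴴ with hA
  have hAA : Aᴴ * A = U * rdiag (fun i => d i * d i) * Uᴴ := by
    rw [hA, conjTranspose_mul, conjTranspose_mul, conjTranspose_rdiag, conjTranspose_conjTranspose,
      ← rdiag_mul]
    calc _ = U * rdiag d * (Uᴴ * U) * rdiag d * Uᴴ := by simp only [mul_assoc]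
      _ = _ := by rw [hU, mul_one]; simp only [mul_assoc]
  have hdd : Antitone fun i => d i * d i := fun a b hab =>
    mul_self_le_mul_self (hd0 b) (hd hab)
  obtain ⟨V, hV, hVe⟩ := exists_diagonalization_eigenvalues₀ (isHermitian_conjTranspose_mul_self A)
  have hant := (isHermitian_conjTranspose_mul_self A).eigenvalues₀_antitone
  have hant' : Antitone fun i => (isHermitian_conjTranspose_mul_self A).eigenvalues₀
      (Fin.cast (Fintype.card_fin n).symm i) := fun a b hab => hant (by simpa using hab)
  rw [singVal_eq_sqrt_eigenvalues₀]
  have hz : ((0 : Matrix (Fin n) (Fin n) ℂ)).PosSemidef := .zero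
  have h1 := le_of_isometry_conj (W := 1) hdd hant' hU hV (by simp)
    (by rw [← hVe, ← hAA]; simpa using hz) j.2 j.2
  have h2 := le_of_isometry_conj (W := 1) hant' hdd hV hU (by simp)
    (by rw [← hVe, ← hAA]; simpa using hz) j.2 j.2
  have h3 := le_antisymm h2 h1
  simp only [Fin.eta] at h3
  rw [h3, Real.sqrt_mul_self (hd0 j)]

lemma singVal_nonneg (X : Matrix (Fin n) (Fin n) ℂ) (j : ℕ) : 0 ≤ singVal X j :=
  LinearMap.singularValues_nonneg _ _

lemma singVal_antitone (X : Matrix (Fin n) (Fin n) ℂ) : Antitone (singVal X) :=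
  LinearMap.singularValues_antitone _

lemma singVal_fin_antitone (X : Matrix (Fin n) (Fin n) ℂ) :
    Antitone fun j : Fin n => singVal X j := fun _ _ hab => singVal_antitone X hab

lemma exists_diagonalization_singVal {A : Matrix (Fin n) (Fin n) ℂ} (hA : A.PosSemidef) :
    ∃ U : Matrix (Fin n) (Fin n) ℂ, Uᴴ * U = 1 ∧ A = U * rdiag (fun j : Fin n => singVal A j) * Uᴴ := by
  obtain ⟨U, hU, hUA⟩ := exists_diagonalization_eigenvalues₀ hA.1
  have hant : Antitone fun i => hA.1.eigenvalues₀ (Fin.cast (Fintype.card_fin n).symm i) :=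
    fun a b hab => hA.1.eigenvalues₀_antitone (by simpa using hab)
  refine ⟨U, hU, ?_⟩
  set d := fun i => hA.1.eigenvalues₀ (Fin.cast (Fintype.card_fin n).symm i)
  have hd0 : ∀ i, 0 ≤ d i := (posSemidef_conj_rdiag_iff hU).1 (hUA ▸ hA)
  have : (fun j : Fin n => singVal A j) = d := by
    ext j
    conv_lhs => rw [hUA]
    exact singVal_eq_of_conj_rdiag hU hant hd0 j
  rw [this]; exact hUA

lemma singVal_le_of_isometry {m : ℕ} {P : Matrix (Fin m) (Fin m) ℂ} {Q : Matrix (Fin n) (Fin n) ℂ}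
    (hP : P.PosSemidef) (hQ : Q.PosSemidef) {W : Matrix (Fin n) (Fin m) ℂ} (hW : Wᴴ * W = 1)
    (h : P ≤ Wᴴ * Q * W) {j : ℕ} (hm : j < m) (hn : j < n) : singVal P j ≤ singVal Q j := by
  obtain ⟨U, hU, hUP⟩ := exists_diagonalization_singVal hP
  obtain ⟨V, hV, hVQ⟩ := exists_diagonalization_singVal hQ
  refine le_of_isometry_conj (singVal_fin_antitone P) (singVal_fin_antitone Q) hU hV hW ?_ hm hn
  rw [← hUP, ← hVQ]
  exact Matrix.le_iff.1 h

lemma singVal_mono {P Q : Matrix (Fin n) (Fin n) ℂ} (hP : P.PosSemidef) (hQ : Q.PosSemidef)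
    (h : P ≤ Q) {j : ℕ} (hj : j < n) : singVal P j ≤ singVal Q j :=
  singVal_le_of_isometry hP hQ (W := 1) (by simp) (by simpa using h) hj hj

/-- The set `s` allows functions controlled only on `(0, ∞)`. -/
lemma singVal_cfc {A : Matrix (Fin n) (Fin n) ℂ} (hA : A.PosSemidef) {f : ℝ → ℝ} {s : Set ℝ}
    (hf : MonotoneOn f s) (hf0 : ∀ t ∈ s, 0 ≤ f t) (hs : ∀ j < n, singVal A j ∈ s) {j : ℕ}
    (hj : j < n) : singVal (cfc f A) j = f (singVal A j) := by
  obtain ⟨U, hU, hUA⟩ := exists_diagonalization_singVal hA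
  conv_lhs => rw [hUA, cfc_conj_rdiag hU]
  exact singVal_eq_of_conj_rdiag hU (d := fun i : Fin n => f (singVal A i))
    (fun a b hab => hf (hs _ b.2) (hs _ a.2) (singVal_fin_antitone A hab))
    (fun i => hf0 _ (hs _ i.2)) ⟨j, hj⟩

lemma singVal_add_smul_one {A : Matrix (Fin n) (Fin n) ℂ} (hA : A.PosSemidef) {t : ℝ} (ht : 0 ≤ t)
    {j : ℕ} (hj : j < n) : singVal (A + t • (1 : Matrix (Fin n) (Fin n) ℂ)) j = singVal A j + t := by
  obtain ⟨U, hU, hUA⟩ := exists_diagonalization_singVal hA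
  have hU' : U * Uᴴ = 1 := mul_eq_one_comm.mp hU
  have h : A + t • (1 : Matrix (Fin n) (Fin n) ℂ)
      = U * rdiag (fun j : Fin n => singVal A j + t) * Uᴴ := by
    have : rdiag (fun j : Fin n => singVal A j + t) = rdiag (fun j : Fin n => singVal A j)
        + t • (1 : Matrix (Fin n) (Fin n) ℂ) := by
      ext a b
      by_cases hab : a = b
      · subst hab; simp [rdiag]
      · simp [rdiag, hab]
    rw [this, mul_add, add_mul, ← hUA, mul_smul_comm, smul_mul_assoc, mul_one, hU']
  rw [h]
  exact singVal_eq_of_conj_rdiag hU (d := fun j : Fin n => singVal A j + t)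
    (fun a b hab => by have := singVal_fin_antitone A hab; simp only at this ⊢; linarith)
    (fun i => add_nonneg (singVal_nonneg _ _) ht) ⟨j, hj⟩

lemma singVal_pos {A : Matrix (Fin n) (Fin n) ℂ} (hA : A.PosDef) {j : ℕ} (hj : j < n) :
    0 < singVal A j := by
  obtain ⟨U, hU, hUA⟩ := exists_diagonalization_singVal hA.posSemidef
  have hU' : U * Uᴴ = 1 := mul_eq_one_comm.mp hU
  have hdet : IsUnit A.det := (Matrix.isUnit_iff_isUnit_det _).1 hA.isUnit
  rw [hUA, det_mul, det_mul, mul_right_comm, ← det_mul, hU', det_one, one_mul, rdiag, det_diagonal,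
    isUnit_iff_ne_zero, Finset.prod_ne_zero_iff] at hdet
  have := hdet ⟨j, hj⟩ (Finset.mem_univ _)
  exact lt_of_le_of_ne (singVal_nonneg _ _) fun h => this (by simp [← h])

lemma singVal_inv {A : Matrix (Fin n) (Fin n) ℂ} (hA : A.PosDef) {j : ℕ} (hj : j < n) :
    singVal A⁻¹ j = (singVal A (n - 1 - j))⁻¹ := by
  obtain ⟨U, hU, hUA⟩ := exists_diagonalization_singVal hA.posSemidef
  have hU' : U * Uᴴ = 1 := mul_eq_one_comm.mp hU
  have hinv : A⁻¹ = U * rdiag (fun i : Fin n => (singVal A i)⁻¹) * Uᴴ := by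
    apply Matrix.inv_eq_left_inv
    conv_lhs => enter [2]; rw [hUA]
    calc _ = U * rdiag (fun i : Fin n => (singVal A i)⁻¹) * (Uᴴ * U) *
          rdiag (fun j : Fin n => singVal A j) * Uᴴ := by simp only [mul_assoc]
      _ = U * (rdiag (fun i : Fin n => (singVal A i)⁻¹) *
          rdiag (fun j : Fin n => singVal A j)) * Uᴴ := by rw [hU, mul_one]; simp only [mul_assoc]
      _ = 1 := by
        rw [rdiag_mul]
        have : (fun i : Fin n => (singVal A i)⁻¹ * singVal A i) = fun _ => 1 := by
          ext i; exact inv_mul_cancel₀ (singVal_pos hA i.2).ne'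
        rw [this, rdiag_one, mul_one, hU']
  rw [hinv, ← conj_rdiag_permute _ _ Fin.revPerm]
  have := singVal_eq_of_conj_rdiag (submatrix_isometry hU (Fin.revPerm (n := n)).injective)
    (d := (fun i : Fin n => (singVal A i)⁻¹) ∘ Fin.revPerm)
    (fun a b hab => by
      simp only [Function.comp_apply]
      exact inv_anti₀ (singVal_pos hA (Fin.is_lt _))
        (singVal_fin_antitone A (by simpa using hab)))
    (fun i => inv_nonneg.2 (singVal_nonneg _ _)) ⟨j, hj⟩
  rw [this]
  simp only [Function.comp_apply, Fin.revPerm_apply, Fin.val_rev]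
  congr 2; omega

end singVal

/-! ### Horn's inequality and its variants for products of extreme singular values. -/

section products

/-- The product of the `k` largest singular values. -/
noncomputable def topProd {n : ℕ} (X : Matrix (Fin n) (Fin n) ℂ) (k : ℕ) : ℝ :=
  ∏ j ∈ Finset.range k, singVal X j

/-- The product of the `k` smallest singular values. -/
noncomputable def botProd {n : ℕ} (X : Matrix (Fin n) (Fin n) ℂ) (k : ℕ) : ℝ :=
  ∏ j ∈ Finset.Ico (n - k) n, singVal X j

variable {n k : ℕ}

lemma botProd_eq_prod_range (X : Matrix (Fin n) (Fin n) ℂ) (hk : k ≤ n) :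
    botProd X k = ∏ j ∈ Finset.range k, singVal X (n - k + j) := by
  rw [botProd, Finset.prod_Ico_eq_prod_range]
  congr 2; omega

lemma topProd_nonneg (X : Matrix (Fin n) (Fin n) ℂ) (k : ℕ) : 0 ≤ topProd X k :=
  Finset.prod_nonneg fun _ _ => singVal_nonneg _ _

lemma botProd_nonneg (X : Matrix (Fin n) (Fin n) ℂ) (k : ℕ) : 0 ≤ botProd X k :=
  Finset.prod_nonneg fun _ _ => singVal_nonneg _ _

lemma topProd_pos {A : Matrix (Fin n) (Fin n) ℂ} (hA : A.PosDef) (hk : k ≤ n) : 0 < topProd A k :=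
  Finset.prod_pos fun _ hj => singVal_pos hA ((Finset.mem_range.1 hj).trans_le hk)

lemma botProd_pos {A : Matrix (Fin n) (Fin n) ℂ} (hA : A.PosDef) : 0 < botProd A k :=
  Finset.prod_pos fun _ hj => singVal_pos hA (Finset.mem_Ico.1 hj).2

lemma det_eq_topProd {P : Matrix (Fin k) (Fin k) ℂ} (hP : P.PosSemidef) :
    P.det = (topProd P k : ℂ) := by
  obtain ⟨U, hU, hUP⟩ := exists_diagonalization_singVal hP
  have hU' : U * Uᴴ = 1 := mul_eq_one_comm.mp hU
  conv_lhs => rw [hUP]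
  rw [det_mul, det_mul, mul_right_comm, ← det_mul, hU', det_one, one_mul, rdiag, det_diagonal,
    topProd, Finset.prod_range]
  push_cast; rfl

lemma topProd_compression_le {Q : Matrix (Fin n) (Fin n) ℂ} (hQ : Q.PosSemidef) (hk : k ≤ n)
    {W : Matrix (Fin n) (Fin k) ℂ} (hW : Wᴴ * W = 1) : topProd (Wᴴ * Q * W) k ≤ topProd Q k :=
  Finset.prod_le_prod (fun _ _ => singVal_nonneg _ _) fun _ hj =>
    singVal_le_of_isometry (hQ.conjTranspose_mul_mul_same W) hQ hW le_rfl (Finset.mem_range.1 hj)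
      ((Finset.mem_range.1 hj).trans_le hk)

lemma exists_isometry_topProd {Q : Matrix (Fin n) (Fin n) ℂ} (hQ : Q.PosSemidef) (hk : k ≤ n) :
    ∃ W : Matrix (Fin n) (Fin k) ℂ, Wᴴ * W = 1 ∧ topProd (Wᴴ * Q * W) k = topProd Q k := by
  obtain ⟨U, hU, hUQ⟩ := exists_diagonalization_singVal hQ
  have hinj : Function.Injective (Fin.castLE hk) := Fin.castLE_injective hk
  refine ⟨U.submatrix id (Fin.castLE hk), submatrix_isometry hU hinj, ?_⟩
  have h : (U.submatrix id (Fin.castLE hk))ᴴ * Q * U.submatrix id (Fin.castLE hk)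
      = 1 * rdiag (fun i : Fin k => singVal Q i) * (1 : Matrix (Fin k) (Fin k) ℂ)ᴴ := by
    have e : (U.submatrix id (Fin.castLE hk))ᴴ * Q * U.submatrix id (Fin.castLE hk)
        = (Uᴴ * Q * U).submatrix (Fin.castLE hk) (Fin.castLE hk) := by
      ext a b
      simp [Matrix.mul_apply]
    rw [e]
    conv_lhs => rw [hUQ]
    have e2 : Uᴴ * (U * rdiag (fun j : Fin n => singVal Q j) * Uᴴ) * U
        = rdiag (fun j : Fin n => singVal Q j) := by
      calc _ = (Uᴴ * U) * rdiag (fun j : Fin n => singVal Q j) * (Uᴴ * U) := by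
            simp only [Matrix.mul_assoc]
        _ = _ := by rw [hU, Matrix.one_mul, Matrix.mul_one]
    rw [e2, Matrix.one_mul, conjTranspose_one, Matrix.mul_one, rdiag, submatrix_diagonal _ _ hinj]
    rfl
  rw [h]
  refine Finset.prod_congr rfl fun j hj => ?_
  exact singVal_eq_of_conj_rdiag (U := 1) (by simp) (d := fun i : Fin k => singVal Q i)
    (fun a b hab => singVal_antitone Q hab) (fun i => singVal_nonneg _ _)
    ⟨j, Finset.mem_range.1 hj⟩

/-- Horn's multiplicative inequality for the products of the `k` largest singular values. -/
lemma topProd_conj_le {S Y : Matrix (Fin n) (Fin n) ℂ} (hS : IsUnit S) (hY : Y.PosSemidef)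
    (hk : k ≤ n) : topProd (Sᴴ * Y * S) k ≤ topProd (Sᴴ * S) k * topProd Y k := by
  obtain ⟨W, hW, hWe⟩ := exists_isometry_topProd (hY.conjTranspose_mul_mul_same S) hk
  have hWinj : Function.Injective W.mulVec := by
    intro x y hxy
    have := congrArg (Wᴴ *ᵥ ·) hxy
    simpa [mulVec_mulVec, hW] using this
  have hSS : (Sᴴ * S).PosDef := PosDef.conjTranspose_mul_self S (Matrix.mulVec_injective_of_isUnit hS)
  have hP : (Wᴴ * (Sᴴ * S) * W).PosDef := hSS.conjTranspose_mul_mul_same hWinj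
  set P := Wᴴ * (Sᴴ * S) * W with hPdef
  set R := CFC.sqrt P with hR
  have hRR : R * R = P := sqrt_mul_sqrt hP.posSemidef
  have hiR : R⁻¹ * R = 1 := inv_sqrt_mul hP
  have hRi : R * R⁻¹ = 1 := sqrt_mul_inv hP
  have hRH : Rᴴ = R := conjTranspose_sqrt P
  have hRiH : (R⁻¹)ᴴ = R⁻¹ := conjTranspose_inv_sqrt P
  -- Polar decomposition `S W = E R` with `E` an isometry. The compression of `S* Y S` by `W` is `R
  -- (E* Y E) R`, so its `k × k` determinant splits into two factors, each the determinant of a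
  -- compression.
  obtain ⟨E, hE⟩ : ∃ E, E = S * W * R⁻¹ := ⟨_, rfl⟩
  have hER : S * W = E * R := by rw [hE, Matrix.mul_assoc, hiR, Matrix.mul_one]
  have hEE : Eᴴ * E = 1 := by
    rw [hE, conjTranspose_mul, conjTranspose_mul, hRiH]
    calc _ = R⁻¹ * P * R⁻¹ := by rw [hPdef]; simp only [Matrix.mul_assoc]
      _ = (R⁻¹ * R) * (R * R⁻¹) := by rw [← hRR]; simp only [Matrix.mul_assoc]
      _ = 1 := by rw [hiR, hRi, Matrix.one_mul]
  have hfac : Wᴴ * (Sᴴ * Y * S) * W = R * (Eᴴ * Y * E) * R := by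
    calc _ = (S * W)ᴴ * Y * (S * W) := by rw [conjTranspose_mul]; simp only [Matrix.mul_assoc]
      _ = _ := by rw [hER, conjTranspose_mul, hRH]; simp only [Matrix.mul_assoc]
  have hdet : (Wᴴ * (Sᴴ * Y * S) * W).det = P.det * (Eᴴ * Y * E).det := by
    rw [hfac, det_mul, det_mul, ← hRR, det_mul]; ring
  rw [det_eq_topProd ((hY.conjTranspose_mul_mul_same S).conjTranspose_mul_mul_same W),
    det_eq_topProd hP.posSemidef, det_eq_topProd (hY.conjTranspose_mul_mul_same E)] at hdet
  have hdet' : topProd (Wᴴ * (Sᴴ * Y * S) * W) k = topProd P k * topProd (Eᴴ * Y * E) k := by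
    exact_mod_cast hdet
  rw [← hWe, hdet']
  exact mul_le_mul (topProd_compression_le hSS.posSemidef hk hW) (topProd_compression_le hY hk hEE)
    (topProd_nonneg _ _) (topProd_nonneg _ _)

lemma topProd_inv {A : Matrix (Fin n) (Fin n) ℂ} (hA : A.PosDef) (hk : k ≤ n) :
    topProd A⁻¹ k = (botProd A k)⁻¹ := by
  rw [botProd_eq_prod_range A hk, topProd, ← Finset.prod_range_reflect, ← Finset.prod_inv_distrib]
  refine Finset.prod_congr rfl fun j hj => ?_
  have := Finset.mem_range.1 hj
  rw [singVal_inv hA (by omega)]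
  congr 2; omega

lemma botProd_inv {A : Matrix (Fin n) (Fin n) ℂ} (hA : A.PosDef) (hk : k ≤ n) :
    botProd A⁻¹ k = (topProd A k)⁻¹ := by
  have h := topProd_inv hA.inv hk
  rw [nonsing_inv_nonsing_inv _ ((Matrix.isUnit_iff_isUnit_det _).1 hA.isUnit)] at h
  rw [h, inv_inv]

lemma topProd_sqrt_conj_le {A Y : Matrix (Fin n) (Fin n) ℂ} (hA : A.PosDef) (hY : Y.PosDef)
    (hk : k ≤ n) : topProd (CFC.sqrt A * Y * CFC.sqrt A) k ≤ topProd A k * topProd Y k := by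
  have := topProd_conj_le (sqrt_posDef hA).isUnit hY.posSemidef hk
  rwa [conjTranspose_sqrt, sqrt_mul_sqrt hA.posSemidef] at this

/-- Horn's inequality for `S = Y^{1/2} A^{1/2}` and the middle factor `Y⁻¹`: here `S* Y⁻¹ S = A` and
`S* S = A^{1/2} Y A^{1/2}`, while `top(Y⁻¹) = 1 / bot(Y)`. -/
lemma topProd_mul_botProd_le {A Y : Matrix (Fin n) (Fin n) ℂ} (hA : A.PosDef) (hY : Y.PosDef)
    (hk : k ≤ n) : topProd A k * botProd Y k ≤ topProd (CFC.sqrt A * Y * CFC.sqrt A) k := by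
  have h := topProd_conj_le ((sqrt_posDef hY).isUnit.mul (sqrt_posDef hA).isUnit)
    hY.inv.posSemidef hk
  rw [conjTranspose_mul, conjTranspose_sqrt, conjTranspose_sqrt] at h
  have e1 : CFC.sqrt A * CFC.sqrt Y * (CFC.sqrt Y * CFC.sqrt A) = CFC.sqrt A * Y * CFC.sqrt A := by
    calc _ = CFC.sqrt A * (CFC.sqrt Y * CFC.sqrt Y) * CFC.sqrt A := by simp only [mul_assoc]
      _ = _ := by rw [sqrt_mul_sqrt hY.posSemidef]
  have e0 : CFC.sqrt Y * Y⁻¹ * CFC.sqrt Y = 1 := by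
    have : Y⁻¹ = (CFC.sqrt Y)⁻¹ * (CFC.sqrt Y)⁻¹ := by
      rw [← Matrix.mul_inv_rev, sqrt_mul_sqrt hY.posSemidef]
    rw [this, ← mul_assoc, sqrt_mul_inv hY, one_mul, inv_sqrt_mul hY]
  have e2 : CFC.sqrt A * CFC.sqrt Y * Y⁻¹ * (CFC.sqrt Y * CFC.sqrt A) = A := by
    calc _ = CFC.sqrt A * (CFC.sqrt Y * Y⁻¹ * CFC.sqrt Y) * CFC.sqrt A := by simp only [mul_assoc]
      _ = _ := by rw [e0, mul_one, sqrt_mul_sqrt hA.posSemidef]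
  rw [e1, e2, topProd_inv hY hk, ← div_eq_mul_inv, le_div_iff₀ (botProd_pos hY)] at h
  exact h

lemma sqrt_conj_posDef {A Y : Matrix (Fin n) (Fin n) ℂ} (hA : A.PosDef) (hY : Y.PosDef) :
    (CFC.sqrt A * Y * CFC.sqrt A).PosDef := by
  have h := hY.posSemidef.mul_mul_conjTranspose_same (CFC.sqrt A)
  rw [conjTranspose_sqrt] at h
  exact h.posDef_iff_isUnit.2
    (((sqrt_posDef hA).isUnit.mul hY.isUnit).mul (sqrt_posDef hA).isUnit)

lemma inv_sqrt_conj {A Y : Matrix (Fin n) (Fin n) ℂ} (hA : A.PosDef) :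
    (CFC.sqrt A * Y * CFC.sqrt A)⁻¹ = CFC.sqrt A⁻¹ * Y⁻¹ * CFC.sqrt A⁻¹ := by
  rw [Matrix.mul_inv_rev, Matrix.mul_inv_rev, hA.posSemidef.inv_sqrt, mul_assoc]

lemma botProd_mul_botProd_le {A Y : Matrix (Fin n) (Fin n) ℂ} (hA : A.PosDef) (hY : Y.PosDef)
    (hk : k ≤ n) : botProd A k * botProd Y k ≤ botProd (CFC.sqrt A * Y * CFC.sqrt A) k := by
  have h := topProd_sqrt_conj_le hA.inv hY.inv hk
  rw [← inv_sqrt_conj hA, topProd_inv (sqrt_conj_posDef hA hY) hk, topProd_inv hA hk,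
    topProd_inv hY hk, ← mul_inv] at h
  exact (inv_le_inv₀ (botProd_pos (sqrt_conj_posDef hA hY))
    (mul_pos (botProd_pos hA) (botProd_pos hY))).1 h

lemma botProd_sqrt_conj_le {A Y : Matrix (Fin n) (Fin n) ℂ} (hA : A.PosDef) (hY : Y.PosDef)
    (hk : k ≤ n) : botProd (CFC.sqrt A * Y * CFC.sqrt A) k ≤ botProd A k * topProd Y k := by
  have h := topProd_mul_botProd_le hA.inv hY.inv hk
  rw [← inv_sqrt_conj hA, topProd_inv (sqrt_conj_posDef hA hY) hk, topProd_inv hA hk,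
    botProd_inv hY hk, ← mul_inv] at h
  exact (inv_le_inv₀ (mul_pos (botProd_pos hA) (topProd_pos hY hk))
    (botProd_pos (sqrt_conj_posDef hA hY))).1 h

end products

/-! ### Jensen's inequality for geometric means. -/

section jensen

lemma midpoint_jensen_pow {g : ℝ → ℝ} (hg : ∀ x y, g ((x + y) / 2) ≤ (g x + g y) / 2) (m : ℕ) :
    ∀ x : ℕ → ℝ, (2 ^ m : ℕ) * g ((∑ i ∈ Finset.range (2 ^ m), x i) / (2 ^ m : ℕ))
      ≤ ∑ i ∈ Finset.range (2 ^ m), g (x i) := by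
  induction m with
  | zero => intro x; simp
  | succ m ih =>
    intro x
    rw [pow_succ, mul_two, Finset.sum_range_add, Finset.sum_range_add]
    have h1 := ih x
    have h2 := ih fun i => x (2 ^ m + i)
    set N : ℕ := 2 ^ m with hN
    have hN0 : (0 : ℝ) < N := by rw [hN]; positivity
    set a := ∑ i ∈ Finset.range N, x i
    set b := ∑ i ∈ Finset.range N, x (N + i)
    have h3 := hg (a / N) (b / N)
    have e : (a + b) / ((N + N : ℕ) : ℝ) = (a / N + b / N) / 2 := by
      push_cast; field_simp; ring
    rw [e]
    push_cast
    nlinarith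

/-- Jensen's inequality with equal weights for a midpoint convex function. -/
lemma midpoint_jensen {g : ℝ → ℝ} (hg : ∀ x y, g ((x + y) / 2) ≤ (g x + g y) / 2) {k : ℕ}
    (hk : 1 ≤ k) (x : ℕ → ℝ) :
    k * g ((∑ i ∈ Finset.range k, x i) / k) ≤ ∑ i ∈ Finset.range k, g (x i) := by
  have hk0 : (0 : ℝ) < k := by exact_mod_cast hk
  set c := (∑ i ∈ Finset.range k, x i) / k with hc
  obtain ⟨r, hr⟩ := Nat.exists_eq_add_of_le (Nat.lt_two_pow_self (n := k)).le
  -- The `k` points are padded with copies of their mean `c` up to `2 ^ k` points. The mean is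
  -- unchanged, and the added terms `g c` cancel from both sides.
  have h := midpoint_jensen_pow hg k fun i => if i < k then x i else c
  rw [hr, Finset.sum_range_add, Finset.sum_range_add] at h
  have e1 : ∑ i ∈ Finset.range k, (if i < k then x i else c) = ∑ i ∈ Finset.range k, x i :=
    Finset.sum_congr rfl fun i hi => by rw [if_pos (Finset.mem_range.1 hi)]
  have e2 : ∑ i ∈ Finset.range k, g (if i < k then x i else c) = ∑ i ∈ Finset.range k, g (x i) :=
    Finset.sum_congr rfl fun i hi => by rw [if_pos (Finset.mem_range.1 hi)]
  have hsum : ∑ i ∈ Finset.range k, x i = k * c := by rw [hc]; field_simp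
  rw [e1, e2, hsum] at h
  simp only [Nat.not_lt.2 (Nat.le_add_right _ _), if_false, Finset.sum_const, Finset.card_range,
    nsmul_eq_mul, Nat.cast_add] at h
  have hkr : (0 : ℝ) < k + r := by positivity
  rw [← add_mul, mul_div_cancel_left₀ _ hkr.ne'] at h
  linarith

lemma rpow_prod_eq_exp {k : ℕ} {y : ℕ → ℝ} (hy : ∀ i < k, 0 < y i) :
    (∏ i ∈ Finset.range k, y i) ^ ((1 : ℝ) / k)
      = Real.exp ((∑ i ∈ Finset.range k, Real.log (y i)) / k) := by
  rw [Real.rpow_def_of_pos (Finset.prod_pos fun i hi => hy i (Finset.mem_range.1 hi)),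
    Real.log_prod fun i hi => (hy i (Finset.mem_range.1 hi)).ne']
  congr 1; ring

/-- Geometric convexity of `f` is midpoint convexity of `s ↦ log f(e^s)`. -/
lemma geom_jensen {f : ℝ → ℝ} (hpos : ∀ t, 0 < t → 0 < f t)
    (hf : ∀ x y, 0 < x → 0 < y → f (√(x * y)) ≤ √(f x * f y)) {k : ℕ} (hk : 1 ≤ k) {x : ℕ → ℝ}
    (hx : ∀ i < k, 0 < x i) :
    f ((∏ i ∈ Finset.range k, x i) ^ ((1 : ℝ) / k))
      ≤ (∏ i ∈ Finset.range k, f (x i)) ^ ((1 : ℝ) / k) := by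
  have hk0 : (0 : ℝ) < k := by exact_mod_cast hk
  have hg : ∀ s t, Real.log (f (Real.exp ((s + t) / 2)))
      ≤ (Real.log (f (Real.exp s)) + Real.log (f (Real.exp t))) / 2 := by
    intro s t
    have h := hf _ _ (Real.exp_pos s) (Real.exp_pos t)
    rw [← Real.exp_add, ← Real.exp_half] at h
    have h' := Real.log_le_log (hpos _ (Real.exp_pos _)) h
    rwa [Real.log_sqrt (mul_pos (hpos _ (Real.exp_pos _)) (hpos _ (Real.exp_pos _))).le,
      Real.log_mul (hpos _ (Real.exp_pos _)).ne' (hpos _ (Real.exp_pos _)).ne'] at h'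
  have h := midpoint_jensen (g := fun s => Real.log (f (Real.exp s))) hg hk fun i => Real.log (x i)
  have e : ∑ i ∈ Finset.range k, Real.log (f (Real.exp (Real.log (x i))))
      = ∑ i ∈ Finset.range k, Real.log (f (x i)) :=
    Finset.sum_congr rfl fun i hi => by rw [Real.exp_log (hx i (Finset.mem_range.1 hi))]
  rw [e] at h
  rw [rpow_prod_eq_exp hx, rpow_prod_eq_exp fun i hi => hpos _ (hx i hi),
    ← Real.log_le_iff_le_exp (hpos _ (Real.exp_pos _)), le_div_iff₀ hk0]
  linarith

lemma geom_jensen_concave {f : ℝ → ℝ} (hpos : ∀ t, 0 < t → 0 < f t)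
    (hf : ∀ x y, 0 < x → 0 < y → √(f x * f y) ≤ f (√(x * y))) {k : ℕ} (hk : 1 ≤ k) {x : ℕ → ℝ}
    (hx : ∀ i < k, 0 < x i) :
    (∏ i ∈ Finset.range k, f (x i)) ^ ((1 : ℝ) / k)
      ≤ f ((∏ i ∈ Finset.range k, x i) ^ ((1 : ℝ) / k)) := by
  have hprod : 0 < ∏ i ∈ Finset.range k, x i :=
    Finset.prod_pos fun i hi => hx i (Finset.mem_range.1 hi)
  have hprod' : 0 < ∏ i ∈ Finset.range k, f (x i) :=
    Finset.prod_pos fun i hi => hpos _ (hx i (Finset.mem_range.1 hi))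
  have h := geom_jensen (f := fun t => (f t)⁻¹) (fun t ht => inv_pos.2 (hpos t ht))
    (fun a b ha hb => by
      rw [← mul_inv, Real.sqrt_inv]
      exact inv_anti₀ (Real.sqrt_pos.2 (mul_pos (hpos a ha) (hpos b hb))) (hf a b ha hb)) hk hx
  rw [Finset.prod_inv_distrib, Real.inv_rpow hprod'.le] at h
  exact (inv_le_inv₀ (hpos _ (Real.rpow_pos_of_pos hprod _)) (Real.rpow_pos_of_pos hprod' _)).1 h

end jensen

/-! ### The representing function on scalars and the scalar mean. -/

section scalar

lemma cfc_rdiag {ι : Type*} [Fintype ι] [DecidableEq ι] (f : ℝ → ℝ) (d : ι → ℝ) :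
    cfc f (rdiag d) = rdiag fun i => f (d i) := by
  simpa using cfc_conj_rdiag (U := (1 : Matrix ι ι ℂ)) (by simp) d f

lemma rdiag_le_rdiag_iff {ι : Type*} [DecidableEq ι] {d e : ι → ℝ} :
    rdiag d ≤ rdiag e ↔ ∀ i, d i ≤ e i := by
  have : rdiag e - rdiag d = rdiag fun i => e i - d i := by simp [rdiag]
  rw [Matrix.le_iff, this, rdiag_posSemidef_iff]
  simp

variable {h : ℝ → ℝ}

lemma IsRepresentingFunction.le_of_le (hh : IsRepresentingFunction h) {a b : ℝ} (ha : 0 ≤ a)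
    (hab : a ≤ b) : h a ≤ h b := by
  have := hh.operatorMonotone.cfc_le_cfc (A := rdiag fun _ : Unit => a)
    (B := rdiag fun _ : Unit => b) (rdiag_posSemidef_iff.2 fun _ => ha)
    (rdiag_posSemidef_iff.2 fun _ => ha.trans hab) (rdiag_le_rdiag_iff.2 fun _ => hab)
  rw [cfc_rdiag, cfc_rdiag, rdiag_le_rdiag_iff] at this
  exact this ()

/-- The `1 × 1` case of Hansen's inequality with contraction `√c`. It says that `h(t)/t` is
nonincreasing on `(0, ∞)`, whence the positivity of `h` and the monotonicity of `transposeFun h`. -/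
lemma IsRepresentingFunction.mul_le (hh : IsRepresentingFunction h) {c y : ℝ} (hc : 0 ≤ c)
    (hc1 : c ≤ 1) (hy : 0 ≤ y) : c * h y ≤ h (c * y) := by
  have hs : √c * √c = c := Real.mul_self_sqrt hc
  have := hh.conj_cfc_le (C := rdiag fun _ : Unit => √c) (Y := rdiag fun _ : Unit => y)
    (rdiag_isHermitian _)
    (by rw [rdiag_mul, ← rdiag_one, rdiag_le_rdiag_iff]; intro _; rw [hs]; exact hc1)
    (rdiag_posSemidef_iff.2 fun _ => hy)
  rw [cfc_rdiag, rdiag_mul, rdiag_mul, rdiag_mul, rdiag_mul, cfc_rdiag, rdiag_le_rdiag_iff] at this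
  have := this ()
  rwa [mul_right_comm, hs, mul_right_comm, hs] at this

lemma IsRepresentingFunction.pos (hh : IsRepresentingFunction h) {t : ℝ} (ht : 0 < t) : 0 < h t := by
  rcases le_total 1 t with h1 | h1
  · have := hh.le_of_le zero_le_one h1
    rw [hh.map_one] at this
    linarith
  · have := hh.mul_le ht.le h1 zero_le_one
    rw [hh.map_one, mul_one] at this
    linarith

lemma IsRepresentingFunction.monotoneOn (hh : IsRepresentingFunction h) :
    MonotoneOn h (Set.Ioi 0) := fun _ ha _ _ hab => hh.le_of_le (le_of_lt ha) hab

lemma IsRepresentingFunction.transposeFun_pos (hh : IsRepresentingFunction h) {t : ℝ}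
    (ht : 0 < t) : 0 < transposeFun h t := mul_pos ht (hh.pos (inv_pos.2 ht))

lemma IsRepresentingFunction.transposeFun_monotoneOn (hh : IsRepresentingFunction h) :
    MonotoneOn (transposeFun h) (Set.Ioi 0) := by
  intro s (hs : 0 < s) t (ht : 0 < t) hst
  have := hh.mul_le (c := s / t) (y := s⁻¹) (by positivity) ((div_le_one ht).2 hst) (by positivity)
  have e : s / t * s⁻¹ = t⁻¹ := by field_simp
  rw [e, div_mul_eq_mul_div, div_le_iff₀ ht] at this
  rw [transposeFun, transposeFun]
  linarith

lemma sqrt_inv_mul_inv (x y : ℝ) : √(x⁻¹ * y⁻¹) = (√(x * y))⁻¹ := by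
  rw [← mul_inv, Real.sqrt_inv]

lemma sqrt_transposeFun_mul {x y : ℝ} (hx : 0 < x) (hy : 0 < y) :
    √(transposeFun h x * transposeFun h y) = √(x * y) * √(h x⁻¹ * h y⁻¹) := by
  rw [← Real.sqrt_mul (mul_pos hx hy).le, transposeFun, transposeFun]
  congr 1; ring

lemma GeomConvex.transposeFun (hc : GeomConvex h) {x y : ℝ} (hx : 0 < x) (hy : 0 < y) :
    transposeFun h (√(x * y)) ≤ √(transposeFun h x * transposeFun h y) := by
  rw [sqrt_transposeFun_mul hx hy, OpMean.transposeFun, ← sqrt_inv_mul_inv]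
  exact mul_le_mul_of_nonneg_left (hc _ _ (inv_pos.2 hx).le (inv_pos.2 hy).le) (Real.sqrt_nonneg _)

lemma GeomConcave.transposeFun (hc : GeomConcave h) {x y : ℝ} (hx : 0 < x) (hy : 0 < y) :
    √(transposeFun h x * transposeFun h y) ≤ transposeFun h (√(x * y)) := by
  rw [sqrt_transposeFun_mul hx hy, OpMean.transposeFun, ← sqrt_inv_mul_inv]
  exact mul_le_mul_of_nonneg_left (hc _ _ (inv_pos.2 hx).le (inv_pos.2 hy).le) (Real.sqrt_nonneg _)

/-- The scalar mean of positive numbers is jointly monotone. -/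
lemma IsRepresentingFunction.mul_div_mono (hh : IsRepresentingFunction h) {a a' b b' : ℝ}
    (ha : 0 < a) (haa : a ≤ a') (hb : 0 ≤ b) (hbb : b ≤ b') :
    a * h (b / a) ≤ a' * h (b' / a') := by
  have ha' : 0 < a' := ha.trans_le haa
  have h1 := hh.mul_le (c := a / a') (y := b / a) (by positivity) ((div_le_one ha').2 haa)
    (by positivity)
  have e : a / a' * (b / a) = b / a' := by field_simp
  rw [e, div_mul_eq_mul_div, div_le_iff₀ ha'] at h1
  have h2 := hh.le_of_le (a := b / a') (b := b' / a') (by positivity) (by gcongr)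
  nlinarith

lemma IsRepresentingFunction.shiftedScalarMean_monotoneOn (hh : IsRepresentingFunction h)
    {a b : ℝ} (ha : 0 ≤ a) (hb : 0 ≤ b) : MonotoneOn (shiftedScalarMean h a b) (Set.Ioi 0) := by
  intro s (hs : 0 < s) t _ hst
  exact hh.mul_div_mono (by linarith) (by linarith) (by linarith) (by linarith)

lemma IsRepresentingFunction.tendsto_scalarMean (hh : IsRepresentingFunction h) {a b : ℝ}
    (ha : 0 ≤ a) (hb : 0 ≤ b) :
    Tendsto (shiftedScalarMean h a b) (𝓝[>] (0 : ℝ)) (𝓝 (scalarMean h a b)) := by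
  refine tendsto_nhds_limUnder
    ⟨_, (hh.shiftedScalarMean_monotoneOn ha hb).tendsto_nhdsGT ⟨0, ?_⟩⟩
  rintro _ ⟨t, ht : 0 < t, rfl⟩
  exact mul_nonneg (by linarith) (hh.nonneg _ (div_nonneg (by linarith) (by linarith)))

lemma IsRepresentingFunction.scalarMean_le (hh : IsRepresentingFunction h) {a b a' b' : ℝ}
    (ha : 0 ≤ a) (hb : 0 ≤ b) (haa : a < a') (hbb : b < b') :
    scalarMean h a b ≤ a' * h (b' / a') := by
  set δ := min (a' - a) (b' - b) with hδ
  have hδ0 : 0 < δ := lt_min (by linarith) (by linarith)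
  have h1 : δ ≤ a' - a := min_le_left _ _
  have h2 : δ ≤ b' - b := min_le_right _ _
  have h3 : scalarMean h a b ≤ shiftedScalarMean h a b δ := by
    refine le_of_tendsto (hh.tendsto_scalarMean ha hb) ?_
    filter_upwards [Ioc_mem_nhdsGT hδ0] with t ht
    exact hh.shiftedScalarMean_monotoneOn ha hb ht.1 hδ0 ht.2
  exact h3.trans (hh.mul_div_mono (by linarith) (by linarith) (by linarith) (by linarith))

/-- Replaces continuity of the scalar mean: for each `δ` some `t` has `f t < a + δ` and `g t < b +
δ`, and joint monotonicity bounds `v` by the mean shifted by `δ`. -/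
lemma IsRepresentingFunction.le_scalarMean (hh : IsRepresentingFunction h) {a b : ℝ} (ha : 0 ≤ a)
    (hb : 0 ≤ b) {v : ℝ} {f g : ℝ → ℝ} (hf : Tendsto f (𝓝[>] 0) (𝓝 a))
    (hg : Tendsto g (𝓝[>] 0) (𝓝 b)) (hf0 : ∀ t, 0 < t → 0 < f t) (hg0 : ∀ t, 0 < t → 0 < g t)
    (hv : ∀ t, 0 < t → v ≤ f t * h (g t / f t)) : v ≤ scalarMean h a b := by
  refine ge_of_tendsto (hh.tendsto_scalarMean ha hb) ?_
  filter_upwards [self_mem_nhdsWithin] with δ (hδ : 0 < δ)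
  obtain ⟨t, ⟨h1, h2⟩, ht⟩ := (((hf.eventually (gt_mem_nhds (show a < a + δ by linarith))).and
    (hg.eventually (gt_mem_nhds (show b < b + δ by linarith)))).and
      (self_mem_nhdsWithin (a := (0 : ℝ)) (s := Set.Ioi 0))).exists
  exact (hv t ht).trans (hh.mul_div_mono (hf0 t ht) h1.le (hg0 t ht).le h2.le)

end scalar

/-! ### The core inequalities for positive definite matrices. -/

section posDef

variable {n k : ℕ}

lemma topGeom_pos {A : Matrix (Fin n) (Fin n) ℂ} (hA : A.PosDef) (hk : k ≤ n) : 0 < topGeom A k :=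
  Real.rpow_pos_of_pos (topProd_pos hA hk) _

lemma botGeom_pos {A : Matrix (Fin n) (Fin n) ℂ} (hA : A.PosDef) : 0 < botGeom A k :=
  Real.rpow_pos_of_pos (botProd_pos hA) _

lemma cfc_posDef {A : Matrix (Fin n) (Fin n) ℂ} (hA : A.PosDef) {f : ℝ → ℝ}
    (hf : ∀ t, 0 < t → 0 < f t) : (cfc f A).PosDef := by
  obtain ⟨U, hU, hUA⟩ := exists_diagonalization_singVal hA.posSemidef
  have hU' : U * Uᴴ = 1 := mul_eq_one_comm.mp hU
  have hpos (i : Fin n) : 0 < f (singVal A i) := hf _ (singVal_pos hA i.2)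
  have e : cfc f A = U * rdiag (fun i : Fin n => f (singVal A i)) * Uᴴ := by
    conv_lhs => rw [hUA, cfc_conj_rdiag hU]
  rw [e]
  refine ((posSemidef_conj_rdiag_iff hU).2 fun i => (hpos i).le).posDef_iff_isUnit.2 ?_
  rw [Matrix.isUnit_iff_isUnit_det, det_mul, det_mul, mul_right_comm, ← det_mul, hU', det_one,
    one_mul, rdiag, det_diagonal, isUnit_iff_ne_zero, Finset.prod_ne_zero_iff]
  exact fun i _ => by exact_mod_cast (hpos i).ne'

/-- Operator monotonicity of `f` is not assumed, so that both `h` and `transposeFun h` can be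
inserted. -/
lemma topGeom_mul_le_topGeom_invMean {f : ℝ → ℝ} (hpos : ∀ t, 0 < t → 0 < f t)
    (hmono : MonotoneOn f (Set.Ioi 0))
    (hf : ∀ x y, 0 < x → 0 < y → f (√(x * y)) ≤ √(f x * f y))
    {A B : Matrix (Fin n) (Fin n) ℂ} (hA : A.PosDef) (hB : B.PosDef) (hk1 : 1 ≤ k) (hk : k ≤ n) :
    topGeom A k * f (botGeom B k / topGeom A k) ≤ topGeom (invMean f A B) k := by
  set C := (CFC.sqrt A)⁻¹ * B * (CFC.sqrt A)⁻¹ with hC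
  have hCpos : C.PosDef := posDef_inv_sqrt_conj hA hB
  have h1 : botProd B k / topProd A k ≤ botProd C k := by
    have := botProd_mul_botProd_le hA.inv hB hk
    rwa [← hA.posSemidef.inv_sqrt, botProd_inv hA hk, inv_mul_eq_div] at this
  have h2 : botGeom B k / topGeom A k ≤ botGeom C k := by
    have := Real.rpow_le_rpow (div_nonneg (botProd_nonneg B k) (topProd_nonneg A k)) h1
      (z := (1 : ℝ) / k) (by positivity)
    rwa [Real.div_rpow (botProd_nonneg _ _) (topProd_nonneg _ _)] at this
  have h3 : f (botGeom B k / topGeom A k) ≤ f (botGeom C k) :=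
    hmono (div_pos (botGeom_pos hB) (topGeom_pos hA hk)) (botGeom_pos hCpos) h2
  have h4 : f (botGeom C k) ≤ botGeom (cfc f C) k := by
    have e1 : botGeom C k = (∏ j ∈ Finset.range k, singVal C (n - k + j)) ^ ((1 : ℝ) / k) := by
      rw [← botProd_eq_prod_range C hk]; rfl
    have e2 : botGeom (cfc f C) k
        = (∏ j ∈ Finset.range k, f (singVal C (n - k + j))) ^ ((1 : ℝ) / k) := by
      rw [botGeom, ← botProd, botProd_eq_prod_range _ hk]
      congr 1
      refine Finset.prod_congr rfl fun j hj => ?_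
      exact singVal_cfc hCpos.posSemidef hmono (fun t ht => (hpos t ht).le)
        (fun j hj => singVal_pos hCpos hj) (by have := Finset.mem_range.1 hj; omega)
    rw [e1, e2]
    exact geom_jensen hpos hf hk1 fun i hi => singVal_pos hCpos (by omega)
  have h5 : topGeom A k * botGeom (cfc f C) k ≤ topGeom (invMean f A B) k := by
    have := Real.rpow_le_rpow (mul_nonneg (topProd_nonneg _ _) (botProd_nonneg _ _))
      (topProd_mul_botProd_le hA (cfc_posDef hCpos hpos) hk) (z := (1 : ℝ) / k) (by positivity)
    rwa [Real.mul_rpow (topProd_nonneg _ _) (botProd_nonneg _ _)] at this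
  exact (mul_le_mul_of_nonneg_left (h3.trans h4) (topGeom_pos hA hk).le).trans h5

lemma botGeom_invMean_le_botGeom_mul {f : ℝ → ℝ} (hpos : ∀ t, 0 < t → 0 < f t)
    (hmono : MonotoneOn f (Set.Ioi 0))
    (hf : ∀ x y, 0 < x → 0 < y → √(f x * f y) ≤ f (√(x * y)))
    {A B : Matrix (Fin n) (Fin n) ℂ} (hA : A.PosDef) (hB : B.PosDef) (hk1 : 1 ≤ k) (hk : k ≤ n) :
    botGeom (invMean f A B) k ≤ botGeom A k * f (topGeom B k / botGeom A k) := by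
  set C := (CFC.sqrt A)⁻¹ * B * (CFC.sqrt A)⁻¹ with hC
  have hCpos : C.PosDef := posDef_inv_sqrt_conj hA hB
  have h1 : topProd C k ≤ topProd B k / botProd A k := by
    have := topProd_sqrt_conj_le hA.inv hB hk
    rwa [← hA.posSemidef.inv_sqrt, topProd_inv hA hk, inv_mul_eq_div] at this
  have h2 : topGeom C k ≤ topGeom B k / botGeom A k := by
    have := Real.rpow_le_rpow (topProd_nonneg C k) h1 (z := (1 : ℝ) / k) (by positivity)
    rwa [Real.div_rpow (topProd_nonneg _ _) (botProd_nonneg _ _)] at this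
  have h3 : f (topGeom C k) ≤ f (topGeom B k / botGeom A k) :=
    hmono (topGeom_pos hCpos hk) (div_pos (topGeom_pos hB hk) (botGeom_pos hA)) h2
  have h4 : topGeom (cfc f C) k ≤ f (topGeom C k) := by
    have e2 : topGeom (cfc f C) k = (∏ j ∈ Finset.range k, f (singVal C j)) ^ ((1 : ℝ) / k) := by
      rw [topGeom]
      congr 1
      refine Finset.prod_congr rfl fun j hj => ?_
      exact singVal_cfc hCpos.posSemidef hmono (fun t ht => (hpos t ht).le)
        (fun j hj => singVal_pos hCpos hj) (by have := Finset.mem_range.1 hj; omega)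
    rw [e2, topGeom]
    exact geom_jensen_concave hpos hf hk1 fun i hi => singVal_pos hCpos (by omega)
  have hCf := cfc_posDef hCpos hpos
  have h5 : botGeom (invMean f A B) k ≤ botGeom A k * topGeom (cfc f C) k := by
    have := Real.rpow_le_rpow (botProd_nonneg _ _)
      (botProd_sqrt_conj_le hA hCf hk) (z := (1 : ℝ) / k) (by positivity)
    rwa [Real.mul_rpow (botProd_nonneg _ _) (topProd_nonneg _ _)] at this
  exact h5.trans (mul_le_mul_of_nonneg_left (h4.trans h3) (botGeom_pos hA).le)

lemma mul_transposeFun_div (h : ℝ → ℝ) {a b : ℝ} (hb : b ≠ 0) :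
    b * transposeFun h (a / b) = a * h (b / a) := by
  rw [transposeFun, inv_div, ← mul_assoc, mul_div_cancel₀ _ hb]

end posDef

/-! ### Passage to positive semidefinite matrices. -/

section limit

variable {n k : ℕ}

lemma prod_singVal_shift {A : Matrix (Fin n) (Fin n) ℂ} (hA : A.PosSemidef) {s : Finset ℕ}
    (hs : ∀ j ∈ s, j < n) {t : ℝ} (ht : 0 ≤ t) :
    ∏ j ∈ s, singVal (A + t • (1 : Matrix (Fin n) (Fin n) ℂ)) j = ∏ j ∈ s, (singVal A j + t) :=
  Finset.prod_congr rfl fun j hj => singVal_add_smul_one hA ht (hs j hj)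

/-- Strictness is what `IsRepresentingFunction.scalarMean_le` needs: the unshifted scalar mean is
compared with the value at strictly larger arguments. -/
lemma geom_lt_geom_shift {A : Matrix (Fin n) (Fin n) ℂ} (hA : A.PosSemidef) {s : Finset ℕ}
    (hs : ∀ j ∈ s, j < n) (hne : s.Nonempty) {t : ℝ} (ht : 0 < t) (hk : 1 ≤ k) :
    (∏ j ∈ s, singVal A j) ^ ((1 : ℝ) / k)
      < (∏ j ∈ s, singVal (A + t • (1 : Matrix (Fin n) (Fin n) ℂ)) j) ^ ((1 : ℝ) / k) := by
  rw [prod_singVal_shift hA hs ht.le]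
  have hk0 : (0 : ℝ) < k := by exact_mod_cast hk
  refine Real.rpow_lt_rpow (Finset.prod_nonneg fun _ _ => singVal_nonneg _ _) ?_ (by positivity)
  have hpos : 0 < ∏ j ∈ s, (singVal A j + t) :=
    Finset.prod_pos fun j _ => add_pos_of_nonneg_of_pos (singVal_nonneg _ _) ht
  by_cases h0 : ∃ j ∈ s, singVal A j = 0
  · obtain ⟨j, hj, hj0⟩ := h0
    rwa [Finset.prod_eq_zero hj hj0]
  · push Not at h0
    exact Finset.prod_lt_prod_of_nonempty
      (fun j hj => lt_of_le_of_ne (singVal_nonneg _ _) (h0 j hj).symm)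
      (fun j _ => by linarith) hne

lemma tendsto_geom_add (X : Matrix (Fin n) (Fin n) ℂ) (s : Finset ℕ) {f : ℝ → ℝ} {l : Filter ℝ}
    (hf : Tendsto f l (𝓝 0)) :
    Tendsto (fun t => (∏ j ∈ s, (singVal X j + f t)) ^ ((1 : ℝ) / k)) l
      (𝓝 ((∏ j ∈ s, singVal X j) ^ ((1 : ℝ) / k))) := by
  have hc : Continuous fun t : ℝ => (∏ j ∈ s, (singVal X j + t)) ^ ((1 : ℝ) / k) :=
    (continuous_finsetProd s fun j _ => by fun_prop).rpow_const fun _ => Or.inr (by positivity)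
  have := (hc.tendsto 0).comp hf
  simpa [Function.comp_def] using this

lemma tendsto_geom_shift {A : Matrix (Fin n) (Fin n) ℂ} (hA : A.PosSemidef) {s : Finset ℕ}
    (hs : ∀ j ∈ s, j < n) :
    Tendsto (fun t : ℝ => (∏ j ∈ s, singVal (A + t • (1 : Matrix (Fin n) (Fin n) ℂ)) j)
      ^ ((1 : ℝ) / k)) (𝓝[>] 0) (𝓝 ((∏ j ∈ s, singVal A j) ^ ((1 : ℝ) / k))) := by
  refine (tendsto_geom_add A s (f := id) (tendsto_id.mono_left nhdsWithin_le_nhds)).congr' ?_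
  filter_upwards [self_mem_nhdsWithin] with t (ht : 0 < t)
  rw [prod_singVal_shift hA hs ht.le, id]

lemma le_trace_smul_one {N : Matrix (Fin n) (Fin n) ℂ} (hN : N.PosSemidef) :
    N ≤ N.trace.re • (1 : Matrix (Fin n) (Fin n) ℂ) := by
  obtain ⟨U, hU, hUN⟩ := exists_diagonalization_singVal hN
  have hU' : U * Uᴴ = 1 := mul_eq_one_comm.mp hU
  have htr : N.trace.re = ∑ j : Fin n, singVal N j := by
    conv_lhs => rw [hUN]
    rw [trace_mul_cycle, hU, one_mul, rdiag, trace_diagonal, ← Complex.ofReal_sum, Complex.ofReal_re]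
  rw [htr, Matrix.le_iff]
  have h : (∑ j : Fin n, singVal N j) • (1 : Matrix (Fin n) (Fin n) ℂ) - N
      = U * rdiag (fun i : Fin n => (∑ j : Fin n, singVal N j) - singVal N i) * Uᴴ := by
    have : rdiag (fun i : Fin n => (∑ j : Fin n, singVal N j) - singVal N i)
        = (∑ j : Fin n, singVal N j) • (1 : Matrix (Fin n) (Fin n) ℂ)
          - rdiag fun i : Fin n => singVal N i := by
      ext a b
      by_cases hab : a = b
      · subst hab; simp [rdiag]
      · simp [rdiag, hab]
    rw [this, mul_sub, sub_mul, ← hUN, mul_smul_comm, smul_mul_assoc, mul_one, hU']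
  rw [h, posSemidef_conj_rdiag_iff hU]
  intro i
  rw [sub_nonneg]
  exact Finset.single_le_sum (f := fun j : Fin n => singVal N j)
    (fun j _ => singVal_nonneg _ _) (Finset.mem_univ i)

lemma shift_posDef {A : Matrix (Fin n) (Fin n) ℂ} (hA : A.PosSemidef) {t : ℝ} (ht : 0 < t) :
    (A + t • (1 : Matrix (Fin n) (Fin n) ℂ)).PosDef :=
  Matrix.PosDef.posSemidef_add hA (PosDef.one.smul ht)

lemma shift_mono (A : Matrix (Fin n) (Fin n) ℂ) {s t : ℝ} (hst : s ≤ t) :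
    A + s • (1 : Matrix (Fin n) (Fin n) ℂ) ≤ A + t • (1 : Matrix (Fin n) (Fin n) ℂ) := by
  rw [Matrix.le_iff, add_sub_add_left_eq_sub, ← sub_smul]
  exact PosSemidef.one.smul (sub_nonneg.2 hst)

variable {h : ℝ → ℝ} {A B : Matrix (Fin n) (Fin n) ℂ}

lemma IsRepresentingFunction.shiftedMean_posSemidef (hh : IsRepresentingFunction h)
    (hB : B.PosSemidef) {t : ℝ} (ht : 0 < t) : (shiftedMean h A B t).PosSemidef :=
  invMean_posSemidef hh.nonneg (shift_posDef hB ht).posSemidef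

lemma IsRepresentingFunction.shiftedMean_mono (hh : IsRepresentingFunction h) (hA : A.PosSemidef)
    (hB : B.PosSemidef) {s t : ℝ} (hs : 0 < s) (hst : s ≤ t) :
    shiftedMean h A B s ≤ shiftedMean h A B t :=
  hh.invMean_mono (shift_posDef hA hs) (shift_posDef hA (hs.trans_le hst)) (shift_mono A hst)
    (shift_posDef hB hs).posSemidef (shift_posDef hB (hs.trans_le hst)).posSemidef (shift_mono B hst)

lemma IsRepresentingFunction.tendsto_mean (hh : IsRepresentingFunction h) (hA : A.PosSemidef)
    (hB : B.PosSemidef) : Tendsto (shiftedMean h A B) (𝓝[>] (0 : ℝ)) (𝓝 (mean h A B)) :=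
  tendsto_nhds_limUnder (exists_tendsto_of_monotone_posSemidef
    (fun _ ht => hh.shiftedMean_posSemidef hB ht) fun _ _ hs hst => hh.shiftedMean_mono hA hB hs hst)

lemma IsRepresentingFunction.mean_posSemidef (hh : IsRepresentingFunction h) (hA : A.PosSemidef)
    (hB : B.PosSemidef) : (mean h A B).PosSemidef := by
  refine isClosed_posSemidef.mem_of_tendsto (hh.tendsto_mean hA hB) ?_
  filter_upwards [self_mem_nhdsWithin] with t ht
  exact hh.shiftedMean_posSemidef hB ht

lemma IsRepresentingFunction.mean_le_shiftedMean (hh : IsRepresentingFunction h)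
    (hA : A.PosSemidef) (hB : B.PosSemidef) {t : ℝ} (ht : 0 < t) :
    mean h A B ≤ shiftedMean h A B t := by
  refine Matrix.le_iff.2 (isClosed_posSemidef.mem_of_tendsto
    (tendsto_const_nhds.sub (hh.tendsto_mean hA hB)) ?_)
  filter_upwards [Ioc_mem_nhdsGT ht] with s hs
  exact Matrix.le_iff.1 (hh.shiftedMean_mono hA hB hs.1 hs.2)

/-- With `M` the limit and `τ` the trace of the positive matrix `A_t σ B_t - M`, one has `A_t σ B_t
≤ M + τ I`. The right side has singular values `μ_j(M) + τ`, and `τ → 0`. -/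
lemma IsRepresentingFunction.le_topGeom_mean (hh : IsRepresentingFunction h) (hA : A.PosSemidef)
    (hB : B.PosSemidef) (hk : k ≤ n) {v : ℝ}
    (hv : ∀ t, 0 < t → v ≤ topGeom (shiftedMean h A B t) k) : v ≤ topGeom (mean h A B) k := by
  set M := mean h A B with hM
  have hτ : Tendsto (fun t => (shiftedMean h A B t - M).trace.re) (𝓝[>] 0) (𝓝 0) := by
    have hc : Continuous fun X : Matrix (Fin n) (Fin n) ℂ => (X - M).trace.re := by
      refine Complex.continuous_re.comp (Continuous.matrix_trace (by fun_prop))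
    have := (hc.tendsto M).comp (hh.tendsto_mean hA hB)
    simpa [Function.comp_def] using this
  refine ge_of_tendsto (tendsto_geom_add (k := k) M (Finset.range k) hτ) ?_
  filter_upwards [self_mem_nhdsWithin] with t (ht : 0 < t)
  refine (hv t ht).trans ?_
  have hMp := hh.mean_posSemidef hA hB
  have hN : (shiftedMean h A B t - M).PosSemidef :=
    Matrix.le_iff.1 (hh.mean_le_shiftedMean hA hB ht)
  set τ := (shiftedMean h A B t - M).trace.re
  have hτ0 : 0 ≤ τ := (Complex.le_def.1 hN.trace_nonneg).1
  have hle : shiftedMean h A B t ≤ M + τ • (1 : Matrix (Fin n) (Fin n) ℂ) :=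
    sub_le_iff_le_add'.1 (le_trace_smul_one hN)
  have hs : ∀ j ∈ Finset.range k, j < n := fun j hj => (Finset.mem_range.1 hj).trans_le hk
  rw [← prod_singVal_shift hMp hs hτ0]
  refine Real.rpow_le_rpow (topProd_nonneg _ _) ?_ (by positivity)
  exact Finset.prod_le_prod (fun _ _ => singVal_nonneg _ _) fun j hj =>
    singVal_mono (hh.shiftedMean_posSemidef hB ht) (hMp.add (PosSemidef.one.smul hτ0)) hle (hs j hj)

lemma IsRepresentingFunction.botGeom_mean_le (hh : IsRepresentingFunction h) (hA : A.PosSemidef)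
    (hB : B.PosSemidef) {t : ℝ} (ht : 0 < t) :
    botGeom (mean h A B) k ≤ botGeom (shiftedMean h A B t) k := by
  refine Real.rpow_le_rpow (botProd_nonneg _ _) ?_ (by positivity)
  exact Finset.prod_le_prod (fun _ _ => singVal_nonneg _ _) fun j hj =>
    singVal_mono (hh.mean_posSemidef hA hB) (hh.shiftedMean_posSemidef hB ht)
      (hh.mean_le_shiftedMean hA hB ht) (Finset.mem_Ico.1 hj).2

lemma topGeom_nonneg (X : Matrix (Fin n) (Fin n) ℂ) (k : ℕ) : 0 ≤ topGeom X k :=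
  Real.rpow_nonneg (topProd_nonneg _ _) _

lemma botGeom_nonneg (X : Matrix (Fin n) (Fin n) ℂ) (k : ℕ) : 0 ≤ botGeom X k :=
  Real.rpow_nonneg (botProd_nonneg _ _) _

lemma topGeom_lt_shift (hA : A.PosSemidef) (hk1 : 1 ≤ k) (hk : k ≤ n) {t : ℝ} (ht : 0 < t) :
    topGeom A k < topGeom (A + t • (1 : Matrix (Fin n) (Fin n) ℂ)) k :=
  geom_lt_geom_shift hA (fun _ hj => (Finset.mem_range.1 hj).trans_le hk)
    (Finset.nonempty_range_iff.2 (by omega)) ht hk1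

lemma botGeom_lt_shift (hA : A.PosSemidef) (hk1 : 1 ≤ k) (hk : k ≤ n) {t : ℝ} (ht : 0 < t) :
    botGeom A k < botGeom (A + t • (1 : Matrix (Fin n) (Fin n) ℂ)) k :=
  geom_lt_geom_shift hA (fun _ hj => (Finset.mem_Ico.1 hj).2)
    (Finset.nonempty_Ico.2 (by omega)) ht hk1

lemma tendsto_topGeom_shift (hA : A.PosSemidef) (hk : k ≤ n) :
    Tendsto (fun t : ℝ => topGeom (A + t • (1 : Matrix (Fin n) (Fin n) ℂ)) k) (𝓝[>] 0)
      (𝓝 (topGeom A k)) :=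
  tendsto_geom_shift hA fun _ hj => (Finset.mem_range.1 hj).trans_le hk

lemma tendsto_botGeom_shift (hA : A.PosSemidef) :
    Tendsto (fun t : ℝ => botGeom (A + t • (1 : Matrix (Fin n) (Fin n) ℂ)) k) (𝓝[>] 0)
      (𝓝 (botGeom A k)) :=
  tendsto_geom_shift hA fun _ hj => (Finset.mem_Ico.1 hj).2

end limit

end OpMean

/-! ### The main theorem. -/

theorem theorem3p1 (h : ℝ → ℝ) (hh : OpMean.IsRepresentingFunction h) :
    -- the limits that define `A σ B` and `a σ b` exist
    (∀ (n : ℕ) (A B : Matrix (Fin n) (Fin n) ℂ), A.PosSemidef → B.PosSemidef →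
      Tendsto (OpMean.shiftedMean h A B) (𝓝[>] (0 : ℝ)) (𝓝 (OpMean.mean h A B))) ∧
    (∀ a b : ℝ, 0 ≤ a → 0 ≤ b →
      Tendsto (OpMean.shiftedScalarMean h a b) (𝓝[>] (0 : ℝ)) (𝓝 (OpMean.scalarMean h a b))) ∧
    -- (i)
    (OpMean.GeomConvex h →
      ∀ (n : ℕ) (A B : Matrix (Fin n) (Fin n) ℂ), A.PosSemidef → B.PosSemidef →
      ∀ k : ℕ, 1 ≤ k → k ≤ n →
        OpMean.scalarMean h (OpMean.topGeom A k) (OpMean.botGeom B k)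
          ≤ OpMean.topGeom (OpMean.mean h A B) k ∧
        OpMean.scalarMean h (OpMean.botGeom A k) (OpMean.topGeom B k)
          ≤ OpMean.topGeom (OpMean.mean h A B) k) ∧
    -- (ii)
    (OpMean.GeomConcave h →
      ∀ (n : ℕ) (A B : Matrix (Fin n) (Fin n) ℂ), A.PosSemidef → B.PosSemidef →
      ∀ k : ℕ, 1 ≤ k → k ≤ n →
        OpMean.botGeom (OpMean.mean h A B) k
          ≤ OpMean.scalarMean h (OpMean.botGeom A k) (OpMean.topGeom B k) ∧
        OpMean.botGeom (OpMean.mean h A B) k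
          ≤ OpMean.scalarMean h (OpMean.topGeom A k) (OpMean.botGeom B k)) := by
  open OpMean in
  refine ⟨fun n A B hA hB => hh.tendsto_mean hA hB, fun a b ha hb => hh.tendsto_scalarMean ha hb,
    fun hc n A B hA hB k hk1 hk => ⟨?_, ?_⟩, fun hc n A B hA hB k hk1 hk => ⟨?_, ?_⟩⟩
  · refine hh.le_topGeom_mean hA hB hk fun t ht => ?_
    exact (hh.scalarMean_le (topGeom_nonneg _ _) (botGeom_nonneg _ _)
      (topGeom_lt_shift hA hk1 hk ht) (botGeom_lt_shift hB hk1 hk ht)).trans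
      (topGeom_mul_le_topGeom_invMean (fun _ => hh.pos) hh.monotoneOn
        (fun x y hx hy => hc x y hx.le hy.le) (shift_posDef hA ht) (shift_posDef hB ht) hk1 hk)
  · refine hh.le_topGeom_mean hA hB hk fun t ht => ?_
    have hA' := shift_posDef hA ht
    have hB' := shift_posDef hB ht
    -- The first inequality for the transposed mean with `A` and `B` exchanged; the rewrite below
    -- turns it back into a statement about `h`.
    have key := topGeom_mul_le_topGeom_invMean (fun _ => hh.transposeFun_pos)
      hh.transposeFun_monotoneOn (fun x y hx hy => hc.transposeFun hx hy) hB' hA' hk1 hk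
    rw [← invMean_transpose h hA' hB', mul_transposeFun_div h (topGeom_pos hB' hk).ne'] at key
    exact (hh.scalarMean_le (botGeom_nonneg _ _) (topGeom_nonneg _ _)
      (botGeom_lt_shift hA hk1 hk ht) (topGeom_lt_shift hB hk1 hk ht)).trans key
  · refine hh.le_scalarMean (botGeom_nonneg _ _) (topGeom_nonneg _ _) (tendsto_botGeom_shift hA)
      (tendsto_topGeom_shift hB hk) (fun t ht => botGeom_pos (shift_posDef hA ht))
      (fun t ht => topGeom_pos (shift_posDef hB ht) hk) fun t ht => ?_
    exact (hh.botGeom_mean_le hA hB ht).trans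
      (botGeom_invMean_le_botGeom_mul (fun _ => hh.pos) hh.monotoneOn
        (fun x y hx hy => hc x y hx.le hy.le) (shift_posDef hA ht) (shift_posDef hB ht) hk1 hk)
  · refine hh.le_scalarMean (topGeom_nonneg _ _) (botGeom_nonneg _ _) (tendsto_topGeom_shift hA hk)
      (tendsto_botGeom_shift hB) (fun t ht => topGeom_pos (shift_posDef hA ht) hk)
      (fun t ht => botGeom_pos (shift_posDef hB ht)) fun t ht => ?_
    have hA' := shift_posDef hA ht
    have hB' := shift_posDef hB ht
    have key := botGeom_invMean_le_botGeom_mul (fun _ => hh.transposeFun_pos)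
      hh.transposeFun_monotoneOn (fun x y hx hy => hc.transposeFun hx hy) hB' hA' hk1 hk
    rw [← invMean_transpose h hA' hB', mul_transposeFun_div h (botGeom_pos hB').ne'] at key
    exact (hh.botGeom_mean_le hA hB ht).trans key
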